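/- For integers $N, w\ge 0$ let $B_N(w)$ denote the set of nonzero vectors of $\{0,1\}^N$ of Hamming weight at most $w$. A binary linear $[N,k,d]$ code is a $k$-dimensional linear subspace of $\mathbb{F}_2^N$ whose minimum distance (the smallest Hamming weight of a nonzero codeword) is $d$. There exist a real constant $b>0$ and infinitely many positive integers $n$ for each of which there is a binary linear $[2n,n,d]$ code, for some $d$, satisfying $$|B_{2n}(d)| \ \ge\ b\,n\,2^n .$$ -/

import Mathlib

/-- A binary linear `[N, k, d]` code: a `k`-dimensional subspace `C` of `𝔽₂ ^ N` whose minimum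
distance, that is, the smallest Hamming weight of a nonzero codeword, is exactly `d`. -/
structure IsBinaryLinearCode (N k d : ℕ) (C : Submodule (ZMod 2) (Fin N → ZMod 2)) : Prop where
  finrank_eq : Module.finrank (ZMod 2) C = k
  isLeast_weight : IsLeast {w : ℕ | ∃ x ∈ C, x ≠ 0 ∧ hammingNorm x = w} d

/-- The punctured Hamming ball `B_N(w)`: the nonzero binary vectors of length `N` of Hamming
weight at most `w`. -/
def puncturedBall (N w : ℕ) : Finset (Fin N → ZMod 2) :=
  {x | x ≠ 0 ∧ hammingNorm x ≤ w}

open Polynomial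

/-! Let n = q^m with q = 6659. Since 2 generates the units modulo every power of q, the only
irreducible factors of X^n - 1 over 𝔽₂ are X - 1 and the cyclotomic Φ_{q^i}, 1 ≤ i ≤ m. Consider the
double circulant codes {(u, a * u)}, with * the product of 𝔽₂[X]/(X^n - 1) and a random. A
Gilbert–Varshamov count shows that some a admits no nonzero word of weight at most w when the ball
of radius w has fewer than n 2^n / 100 elements; the theorem follows by taking w maximal.

The extra factor n comes from symmetry: a light word whose u lacks the period n/q has n distinct
shifts in the code (`mul_card_badPrimitive_le`). Two obstacles remain. If u and v share the factor
Φ_{q^{j+1}}, up to 2^{q^{j+1}} multipliers may send u to v. Such pairs are rare, because their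
coordinate sums modulo q^{j+1} are confined to a small set while Krawtchouk estimates spread these
sums out on each weight layer (`two_pow_mul_card_cyclotomicDvd_le`). Words with period n/q come from
length 2n/q, at weight w/q. The ball there is at most a q-th root of the original one
(`card_weightBall_level_le`), and induction on the exponent (`card_badMultiplier_pow_le`) shows that
they spoil at most a third of the multipliers. -/

/-! ### Irreducibility over 𝔽₂ of the cyclotomic polynomials of index a power of q. -/

theorem pow_totient_dvd_orderOf_two {q k e : ℕ} (hq : q.Prime) (hq2 : q ≠ 2)
    (hord : orderOf (2 : ZMod q) = q - 1) (hw : ¬ q ^ 2 ∣ 2 ^ (q - 1) - 1)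
    (he : e ≠ 0) (hk : k ≠ 0) (h : q ^ k ∣ 2 ^ e - 1) : q ^ (k - 1) * (q - 1) ∣ e := by
  have : Fact q.Prime := ⟨hq⟩
  have hodd : Odd q := hq.odd_of_ne_two hq2
  have hq1 : 2 ≤ q := hq.two_le
  have key : ∀ a : ℕ, q ∣ 2 ^ a - 1 ↔ q - 1 ∣ a := by
    intro a
    rw [← hord, orderOf_dvd_iff_pow_eq_one, ← CharP.cast_eq_zero_iff (ZMod q) q,
      Nat.cast_sub Nat.one_le_two_pow]
    simp [sub_eq_zero]
  obtain ⟨c, rfl⟩ := (key e).1 ((dvd_pow_self q hk).trans h)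
  have hc : c ≠ 0 := by rintro rfl; simp at he
  have h1 : q ∣ 2 ^ (q - 1) - 1 := (key _).2 dvd_rfl
  have hlt : 1 < 2 ^ (q - 1) := Nat.one_lt_two_pow (by omega)
  have hnd : ¬ q ∣ 2 ^ (q - 1) := fun hd => hq2 <|
    (Nat.prime_dvd_prime_iff_eq hq Nat.prime_two).1 (hq.dvd_of_dvd_pow hd)
  -- Lifting the exponent: v_q(2^((q-1)c) - 1) = v_q(2^(q-1) - 1) + v_q(c), and the first summand is
  -- less than 2 because q is not a Wieferich prime.
  have hlte := padicValNat.pow_sub_pow (p := q) hodd hlt h1 hnd hc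
  rw [one_pow, ← pow_mul] at hlte
  have hne : 2 ^ (q - 1) - 1 ≠ 0 := by omega
  have hne' : 2 ^ ((q - 1) * c) - 1 ≠ 0 := by
    have : 1 < 2 ^ ((q - 1) * c) := Nat.one_lt_two_pow he
    omega
  have hv1 : padicValNat q (2 ^ (q - 1) - 1) < 2 := by
    by_contra! hcon
    exact hw ((padicValNat_dvd_iff_le hne).2 hcon)
  have hvk : k ≤ padicValNat q (2 ^ ((q - 1) * c) - 1) := (padicValNat_dvd_iff_le hne').1 h
  rw [mul_comm]
  refine mul_dvd_mul_left _ ((padicValNat_dvd_iff_le hc).2 ?_)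
  omega

/-- The irreducible factors of Φ_N over 𝔽₂ have degree the order of 2 modulo N, here the full
totient. -/
theorem irreducible_cyclotomic_prime_pow_two {q k : ℕ} (hq : q.Prime) (hq2 : q ≠ 2)
    (hord : orderOf (2 : ZMod q) = q - 1) (hw : ¬ q ^ 2 ∣ 2 ^ (q - 1) - 1) (hk : k ≠ 0) :
    Irreducible (cyclotomic (q ^ k) (ZMod 2)) := by
  have hnd : ¬ 2 ∣ q ^ k := fun hd => hq2 <|
    ((Nat.prime_dvd_prime_iff_eq Nat.prime_two hq).1 (Nat.prime_two.dvd_of_dvd_pow hd)).symm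
  refine ZMod.irreducible_of_dvd_cyclotomic_of_natDegree hnd dvd_rfl ?_
  rw [natDegree_cyclotomic]
  have : NeZero (q ^ k) := ⟨pow_ne_zero _ hq.ne_zero⟩
  refine Nat.dvd_antisymm ?_ ?_
  · rw [Nat.totient_prime_pow hq (Nat.pos_of_ne_zero hk)]
    refine pow_totient_dvd_orderOf_two hq hq2 hord hw (orderOf_pos _).ne' hk ?_
    have h1 := congrArg Units.val (pow_orderOf_eq_one
      (ZMod.unitOfCoprime 2 (Nat.prime_two.coprime_iff_not_dvd.mpr hnd)))
    rw [Units.val_pow_eq_pow_val, ZMod.coe_unitOfCoprime, Units.val_one] at h1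
    rw [← CharP.cast_eq_zero_iff (ZMod (q ^ k)) (q ^ k), Nat.cast_sub Nat.one_le_two_pow]
    push_cast at h1 ⊢
    rw [h1, sub_self]
  · rw [← ZMod.card_units_eq_totient]
    exact orderOf_dvd_card

theorem prime_6659 : Nat.Prime 6659 := by norm_num

set_option exponentiation.threshold 10000 in
theorem two_pow_mod_6659 : 2 ^ 3329 % 6659 = 6658 := by norm_num1

set_option exponentiation.threshold 10000 in
theorem not_sq_6659_dvd : ¬ 6659 ^ 2 ∣ 2 ^ (6659 - 1) - 1 := by norm_num1

/-- As 6658 = 2 · 3329 with 3329 prime, it suffices that 2^3329 = -1 and 2^2 ≠ 1. -/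
theorem orderOf_two_zmod_6659 : orderOf (2 : ZMod 6659) = 6659 - 1 := by
  have : Fact (Nat.Prime 6659) := ⟨prime_6659⟩
  have h2 : (2 : ZMod 6659) ^ 3329 = -1 := by
    have h : ((2 ^ 3329 : ℕ) : ZMod 6659) = (6658 : ℕ) :=
      (ZMod.natCast_eq_natCast_iff _ _ _).2 (two_pow_mod_6659.trans (by norm_num))
    rw [Nat.cast_pow, Nat.cast_ofNat] at h
    rw [h, eq_neg_iff_add_eq_zero]
    exact_mod_cast ZMod.natCast_self 6659
  refine orderOf_eq_of_pow_and_pow_div_prime (by norm_num) ?_ ?_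
  · rw [show 6659 - 1 = 3329 * 2 by norm_num, pow_mul, h2, neg_one_sq]
  · intro p hpp hpd
    rw [show 6659 - 1 = 2 * 3329 by norm_num, hpp.dvd_mul,
      Nat.prime_dvd_prime_iff_eq hpp Nat.prime_two,
      Nat.prime_dvd_prime_iff_eq hpp (by norm_num)] at hpd
    rcases hpd with rfl | rfl
    · rw [show (6659 - 1) / 2 = 3329 by norm_num, h2]
      have : Fact (2 < 6659) := ⟨by norm_num⟩
      exact ZMod.neg_one_ne_one
    · rw [show (6659 - 1) / 3329 = 2 by norm_num]
      intro h
      have h4 : ((4 : ℕ) : ZMod 6659) = (1 : ℕ) := by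
        push_cast
        rw [← h]
        ring
      rw [ZMod.natCast_eq_natCast_iff] at h4
      exact absurd h4 (by decide)

theorem irreducible_cyclotomic_6659_pow {k : ℕ} (hk : k ≠ 0) :
    Irreducible (cyclotomic (6659 ^ k) (ZMod 2)) :=
  irreducible_cyclotomic_prime_pow_two prime_6659 (by norm_num) orderOf_two_zmod_6659
    not_sq_6659_dvd hk

/-! ### Upper bounds for Krawtchouk coefficients. -/

theorem abs_coeff_mul_le {P P' Q Q' : ℝ[X]} (h : ∀ k, |P.coeff k| ≤ Q.coeff k)
    (h' : ∀ k, |P'.coeff k| ≤ Q'.coeff k) (k : ℕ) : |(P * P').coeff k| ≤ (Q * Q').coeff k := by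
  rw [coeff_mul, coeff_mul]
  refine (Finset.abs_sum_le_sum_abs _ _).trans (Finset.sum_le_sum fun x _ => ?_)
  rw [abs_mul]
  exact mul_le_mul (h _) (h' _) (abs_nonneg _) ((abs_nonneg _).trans (h _))

theorem abs_coeff_pow_le {P Q : ℝ[X]} (h : ∀ k, |P.coeff k| ≤ Q.coeff k) (j k : ℕ) :
    |(P ^ j).coeff k| ≤ (Q ^ j).coeff k := by
  induction j generalizing k with
  | zero => simp only [pow_zero, coeff_one]; split_ifs <;> simp
  | succ j ih => rw [pow_succ, pow_succ]; exact abs_coeff_mul_le ih h k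

/-- The left side lacks only the term 2 · C(N, t+1) of C(N+2, t+2). The hypotheses keep t + 2 and N
- t proportional to N, so C(N, t+1) is at least 1/128 of C(N+2, t+2): the loss is 1/64. -/
theorem choose_add_choose_le {n N t : ℕ} (hn : 0 < n) (ht : n ≤ 16 * (t + 2)) (hN : N + 2 ≤ 2 * n)
    (hNt : 2 * (t + 2) + n ≤ 2 * (N + 2)) :
    ((N.choose (t + 2) : ℝ) + N.choose t) ≤ 63 / 64 * (N + 2).choose (t + 2) := by
  have h1 : (N + 2).choose (t + 2) = N.choose t + 2 * N.choose (t + 1) + N.choose (t + 2) := by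
    rw [Nat.choose_succ_succ' (N + 1) (t + 1), Nat.choose_succ_succ' N t,
      Nat.choose_succ_succ' N (t + 1)]
    ring
  have h2 : (N + 2).choose (t + 2) * ((t + 2) * (N - t)) =
      (N + 2) * (N + 1) * N.choose (t + 1) := by
    have e1 := Nat.add_one_mul_choose_eq (N + 1) (t + 1)
    have e2 := Nat.choose_mul_succ_eq N (t + 1)
    have e3 : N + 1 - (t + 1) = N - t := by omega
    rw [e3] at e2
    calc _ = ((N + 1 + 1).choose (t + 1 + 1) * (t + 1 + 1)) * (N - t) := by ring
      _ = (N + 2) * ((N + 1).choose (t + 1) * (N - t)) := by rw [← e1]; ring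
      _ = _ := by rw [← e2]; ring
  have h3 : (N + 2) * (N + 1) ≤ 128 * ((t + 2) * (N - t)) := by
    have a1 : N + 2 ≤ 32 * (t + 2) := by omega
    have a2 : N + 1 ≤ 4 * (N - t) := by omega
    calc _ ≤ (32 * (t + 2)) * (4 * (N - t)) := Nat.mul_le_mul a1 a2
      _ = _ := by ring
  have h4 : (N + 2).choose (t + 2) ≤ 128 * N.choose (t + 1) := by
    have hpos : 0 < (t + 2) * (N - t) := by
      have : 0 < N - t := by omega
      positivity
    refine Nat.le_of_mul_le_mul_right ?_ hpos
    rw [h2]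
    calc _ ≤ 128 * ((t + 2) * (N - t)) * N.choose (t + 1) := Nat.mul_le_mul_right _ h3
      _ = _ := by ring
  have h1' : ((N + 2).choose (t + 2) : ℝ) =
    N.choose t + 2 * N.choose (t + 1) + N.choose (t + 2) := by exact_mod_cast h1
  have h4' : ((N + 2).choose (t + 2) : ℝ) ≤ 128 * N.choose (t + 1) := by exact_mod_cast h4
  linarith

/-- Replacing a factor (1 + X)^2 by 1 + X^2 costs a factor 63/64. Each replacement may lower the
index by 2; the slack 32 r keeps it at least n/16 throughout. -/
theorem coeff_one_add_sq_pow_mul_le {n s : ℕ} (hn : 0 < n) (r t : ℕ) (ht : n + 32 * r ≤ 16 * t)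
    (hs : s + 2 * r ≤ 2 * n) (hst : 2 * t + n ≤ 2 * s) :
    ((1 + X ^ 2 : ℝ[X]) ^ r * (1 + X) ^ s).coeff t ≤ (63 / 64 : ℝ) ^ r * (s + 2 * r).choose t := by
  induction r generalizing t with
  | zero => simp [coeff_one_add_X_pow]
  | succ r ih =>
    obtain ⟨t, rfl⟩ : ∃ t', t = t' + 2 := ⟨t - 2, by omega⟩
    have e : (1 + X ^ 2 : ℝ[X]) ^ (r + 1) * (1 + X) ^ s =
        (1 + X ^ 2) ^ r * (1 + X) ^ s + ((1 + X ^ 2) ^ r * (1 + X) ^ s) * X ^ 2 := by ring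
    rw [e, coeff_add, coeff_mul_X_pow]
    have i1 := ih (t + 2) (by omega) (by omega) (by omega)
    have i2 := ih t (by omega) (by omega) (by omega)
    have i3 := choose_add_choose_le (N := s + 2 * r) (t := t) hn (by omega) (by omega) (by omega)
    rw [show s + 2 * (r + 1) = s + 2 * r + 2 by ring]
    calc _ ≤ (63 / 64 : ℝ) ^ r * (((s + 2 * r).choose (t + 2) : ℝ) + (s + 2 * r).choose t) := by
          rw [mul_add]; exact add_le_add i1 i2
      _ ≤ (63 / 64 : ℝ) ^ r * (63 / 64 * (s + 2 * r + 2).choose (t + 2)) := by gcongr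
      _ = _ := by ring

/-- Pair r factors 1 - X with r factors 1 + X to get (1 - X^2)^r; then make every sign positive. -/
theorem abs_coeff_krawtchouk_le {j k r t : ℕ} (hj : r ≤ j) (hk : r ≤ k) :
    |((1 - X : ℝ[X]) ^ j * (1 + X) ^ k).coeff t| ≤
      ((1 + X ^ 2 : ℝ[X]) ^ r * (1 + X) ^ (j + k - 2 * r)).coeff t := by
  obtain ⟨j, rfl⟩ := Nat.exists_eq_add_of_le hj
  obtain ⟨k, rfl⟩ := Nat.exists_eq_add_of_le hk
  have e1 : (1 - X : ℝ[X]) ^ (r + j) * (1 + X) ^ (r + k) =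
      (1 - X ^ 2) ^ r * ((1 - X) ^ j * (1 + X) ^ k) := by
    rw [show (1 - X ^ 2 : ℝ[X]) = (1 - X) * (1 + X) by ring, mul_pow]; ring
  have e2 : (1 + X : ℝ[X]) ^ (r + j + (r + k) - 2 * r) = (1 + X) ^ j * (1 + X) ^ k := by
    rw [← pow_add]; congr 1; omega
  rw [e1, e2]
  have hm : ∀ (d : ℕ) (k : ℕ), |(1 - X ^ (d + 1) : ℝ[X]).coeff k| ≤
      (1 + X ^ (d + 1) : ℝ[X]).coeff k := by
    intro d k
    rw [coeff_sub, coeff_add, coeff_one, coeff_X_pow]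
    split_ifs <;> norm_num
  have hp : ∀ k : ℕ, |(1 + X : ℝ[X]).coeff k| ≤ (1 + X : ℝ[X]).coeff k := by
    intro k
    rw [coeff_add, coeff_one, coeff_X]
    split_ifs <;> norm_num
  have hm0 := hm 0
  simp only [zero_add, pow_one] at hm0
  exact abs_coeff_mul_le (abs_coeff_pow_le (hm 1) r)
    (abs_coeff_mul_le (abs_coeff_pow_le hm0 j) (abs_coeff_pow_le hp k)) t

/-- The natural exponent is min(j, k, r). The sum of three powers replaces it so that the later sum
over subsets factors. -/
theorem abs_krawtchouk_le {n j k r t : ℕ} (hjk : j + k = 2 * n) (ht : n < 8 * t) (htn : t < n)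
    (hr : 32 * r ≤ n) :
    |((1 - X : ℝ[X]) ^ j * (1 + X) ^ k).coeff t| ≤
      ((63 / 64 : ℝ) ^ j + (63 / 64) ^ k + (63 / 64) ^ r) * (2 * n).choose t := by
  have main : ∀ r', r' ≤ j → r' ≤ k → r' ≤ r → |((1 - X : ℝ[X]) ^ j * (1 + X) ^ k).coeff t| ≤
      (63 / 64 : ℝ) ^ r' * (2 * n).choose t := by
    intro r' h1 h2 h3
    refine (abs_coeff_krawtchouk_le h1 h2).trans ?_
    rw [hjk]
    have h := coeff_one_add_sq_pow_mul_le (n := n) (s := 2 * n - 2 * r') (by omega) r' t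
      (by omega) (by omega) (by omega)
    rwa [Nat.sub_add_cancel (by omega)] at h
  have hj : (0 : ℝ) ≤ (63 / 64) ^ j * (2 * n).choose t := by positivity
  have hk : (0 : ℝ) ≤ (63 / 64) ^ k * (2 * n).choose t := by positivity
  have hr : (0 : ℝ) ≤ (63 / 64) ^ r * (2 * n).choose t := by positivity
  rw [add_mul, add_mul]
  rcases le_total j k with hjk | hjk
  · rcases le_total j r with hjr | hjr
    · linarith [main j le_rfl hjk hjr]
    · linarith [main r hjr (hjr.trans hjk) le_rfl]
  · rcases le_total k r with hjr | hjr
    · linarith [main k hjk le_rfl hjr]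
    · linarith [main r (hjr.trans hjk) hjr le_rfl]

/-! ### Fourier analysis of fibre sums on a weight layer. -/

/-- The sign character of `ZMod 2`. -/
noncomputable def sgn (b : ZMod 2) : ℝ := if b = 0 then 1 else -1

theorem sgn_add (a b : ZMod 2) : sgn (a + b) = sgn a * sgn b := by
  unfold sgn
  revert a b
  have : ∀ a : ZMod 2, a = 0 ∨ a = 1 := by decide
  intro a b
  rcases this a with rfl | rfl <;> rcases this b with rfl | rfl <;>
    simp [show (1 + 1 : ZMod 2) = 0 by decide]

theorem abs_sgn (a : ZMod 2) : |sgn a| = 1 := by unfold sgn; split_ifs <;> simp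

theorem sgn_sum {ι : Type*} (s : Finset ι) (x : ι → ZMod 2) :
    sgn (∑ i ∈ s, x i) = ∏ i ∈ s, sgn (x i) := by
  classical
  induction s using Finset.induction_on with
  | empty => simp [sgn]
  | insert a s ha ih => rw [Finset.sum_insert ha, Finset.prod_insert ha, sgn_add, ih]

theorem sum_hammingNorm_eq_prod {ι : Type*} [Fintype ι] [DecidableEq ι] (ε : ι → ℝ) (t : ℕ) :
    ∑ x : ι → ZMod 2 with hammingNorm x = t, ∏ i, (if x i = 0 then 1 else ε i) =
      (∏ i, (1 + C (ε i) * X)).coeff t := by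
  have h : ∀ i, (1 + C (ε i) * X : ℝ[X]) =
      ∑ b : ZMod 2, if b = 0 then 1 else C (ε i) * X := by
    intro i
    rw [show (Finset.univ : Finset (ZMod 2)) = {0, 1} by decide, Finset.sum_pair (by decide)]
    simp
  simp_rw [h]
  rw [Finset.prod_univ_sum, finsetSum_coeff, Fintype.piFinset_univ, Finset.sum_filter]
  refine Finset.sum_congr rfl fun x _ => ?_
  have e : (∏ i, (if x i = 0 then 1 else C (ε i) * X) : ℝ[X]) =
      C (∏ i, (if x i = 0 then 1 else ε i)) * X ^ hammingNorm x := by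
    rw [map_prod, hammingNorm, Finset.card_filter, ← Finset.prod_pow_eq_pow_sum,
      ← Finset.prod_mul_distrib]
    refine Finset.prod_congr rfl fun i _ => ?_
    by_cases hx : x i = 0 <;> simp [hx]
  rw [e, coeff_C_mul, coeff_X_pow]
  simp [eq_comm]

/-- The vector of the sums of the coordinates of `x` over the fibres of `p`. -/
def fiberSum {ι κ : Type*} [Fintype ι] [DecidableEq κ] (p : ι → κ) (x : ι → ZMod 2) (c : κ) :
    ZMod 2 :=
  ∑ i with p i = c, x i

/-- Fourier inversion on 𝔽₂^κ. The character of T evaluated on fibre sums is a sign -1 on f · |T|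
coordinates, so its sum over the layer of weight t is a Krawtchouk coefficient. -/
theorem two_pow_mul_card_fiberSum_le {ι κ : Type*} [Fintype ι] [DecidableEq ι] [Fintype κ]
    [DecidableEq κ] (p : ι → κ) (f : ℕ) (hf : ∀ c, ({i | p i = c} : Finset ι).card = f) (t : ℕ)
    (z : κ → ZMod 2) :
    (2 : ℝ) ^ Fintype.card κ *
        ({x : ι → ZMod 2 | hammingNorm x = t ∧ fiberSum p x = z} : Finset _).card ≤
      ∑ T : Finset κ, |((1 - X : ℝ[X]) ^ (f * T.card) *
        (1 + X) ^ (f * (Fintype.card κ - T.card))).coeff t| := by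
  have hT : ∀ T : Finset κ, ∑ x : ι → ZMod 2 with hammingNorm x = t,
      ∏ c ∈ T, sgn (fiberSum p x c) = ((1 - X : ℝ[X]) ^ (f * T.card) *
        (1 + X) ^ (f * (Fintype.card κ - T.card))).coeff t := by
    intro T
    have h1 : ∀ x : ι → ZMod 2, ∏ c ∈ T, sgn (fiberSum p x c) =
        ∏ i, (if x i = 0 then 1 else (if p i ∈ T then -1 else 1)) := by
      intro x
      simp_rw [fiberSum, sgn_sum]
      rw [Finset.prod_fiberwise_eq_prod_filter, Finset.prod_filter]
      refine Finset.prod_congr rfl fun i _ => ?_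
      unfold sgn
      split_ifs <;> rfl
    have hcard : ∀ U : Finset κ, ({i | p i ∈ U} : Finset ι).card = f * U.card := by
      intro U
      rw [Finset.card_eq_sum_card_fiberwise (f := p) (t := U) (by intro i; simp)]
      rw [Finset.sum_congr rfl (g := fun _ => f), Finset.sum_const, smul_eq_mul, mul_comm]
      intro c hc
      rw [← hf c, Finset.filter_filter]
      congr 1
      ext i
      simp only [Finset.mem_filter, Finset.mem_univ, true_and, and_iff_right_iff_imp]
      rintro rfl
      exact hc
    simp_rw [h1]
    rw [sum_hammingNorm_eq_prod, ← Finset.prod_filter_mul_prod_filter_not _ (fun i => p i ∈ T)]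
    congr 2
    · rw [Finset.prod_congr rfl (g := fun _ => (1 - X : ℝ[X])), Finset.prod_const, hcard]
      intro i hi
      rw [if_pos (Finset.mem_filter.1 hi).2]
      simp [sub_eq_add_neg]
    · rw [Finset.prod_congr rfl (g := fun _ => (1 + X : ℝ[X])), Finset.prod_const,
        ← Finset.card_compl, ← hcard]
      · simp
      · intro i hi
        rw [if_neg (Finset.mem_filter.1 hi).2]
        simp
  -- A factor is 2 where the two vectors agree and 0 where they differ.
  have hind : ∀ x : ι → ZMod 2, (if fiberSum p x = z then (2 : ℝ) ^ Fintype.card κ else 0) =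
      ∏ c, (1 + sgn (z c) * sgn (fiberSum p x c)) := by
    intro x
    simp_rw [← sgn_add]
    split_ifs with h
    · rw [h]
      simp [sgn, CharTwo.add_self_eq_zero, one_add_one_eq_two]
    · obtain ⟨c, hc⟩ := Function.ne_iff.1 h
      refine (Finset.prod_eq_zero (Finset.mem_univ c) ?_).symm
      rw [sgn, if_neg, add_neg_cancel]
      rwa [add_comm, ← CharTwo.sub_eq_add, sub_eq_zero]
  calc (2 : ℝ) ^ Fintype.card κ *
        ({x : ι → ZMod 2 | hammingNorm x = t ∧ fiberSum p x = z} : Finset _).card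
      = ∑ x : ι → ZMod 2 with hammingNorm x = t,
          ∏ c, (1 + sgn (z c) * sgn (fiberSum p x c)) := by
        simp_rw [← hind]
        rw [← Finset.sum_filter, Finset.filter_filter, Finset.sum_const, nsmul_eq_mul, mul_comm]
    _ = ∑ T : Finset κ, (∏ c ∈ T, sgn (z c)) * ∑ x : ι → ZMod 2 with hammingNorm x = t,
          ∏ c ∈ T, sgn (fiberSum p x c) := by
        simp_rw [Finset.prod_one_add, Finset.powerset_univ, Finset.prod_mul_distrib]
        rw [Finset.sum_comm]
        simp_rw [Finset.mul_sum]
    _ ≤ _ := by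
        refine Finset.sum_le_sum fun T _ => ?_
        rw [hT]
        refine (le_abs_self _).trans ?_
        rw [abs_mul, Finset.abs_prod]
        simp [abs_sgn]

theorem two_pow_mul_card_fiberSum_le_choose {ι κ : Type*} [Fintype ι] [DecidableEq ι] [Fintype κ]
    [DecidableEq κ] (p : ι → κ) {f n r t : ℕ} (hf : ∀ c, ({i | p i = c} : Finset ι).card = f)
    (hn : f * Fintype.card κ = 2 * n) (ht : n < 8 * t) (htn : t < n) (hr : 32 * r ≤ n)
    (z : κ → ZMod 2) :
    (2 : ℝ) ^ Fintype.card κ *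
        ({x : ι → ZMod 2 | hammingNorm x = t ∧ fiberSum p x = z} : Finset _).card ≤
      (2 * (1 + (63 / 64 : ℝ) ^ f) ^ Fintype.card κ + 2 ^ Fintype.card κ * (63 / 64 : ℝ) ^ r) *
        (2 * n).choose t := by
  refine (two_pow_mul_card_fiberSum_le p f hf t z).trans ?_
  have hsum : ∑ T : Finset κ, ((63 / 64 : ℝ) ^ f) ^ T.card =
      (1 + (63 / 64 : ℝ) ^ f) ^ Fintype.card κ := by
    have := Finset.prod_one_add (f := fun _ : κ => (63 / 64 : ℝ) ^ f) Finset.univ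
    simpa using this.symm
  have hsum' : ∑ T : Finset κ, ((63 / 64 : ℝ) ^ f) ^ (Fintype.card κ - T.card) =
      (1 + (63 / 64 : ℝ) ^ f) ^ Fintype.card κ := by
    rw [← hsum]
    refine Fintype.sum_equiv (Function.Involutive.toPerm _ (compl_involutive (α := Finset κ))) _ _
      fun T => ?_
    simp [Finset.card_compl]
  calc _ ≤ ∑ T : Finset κ, (((63 / 64 : ℝ) ^ f) ^ T.card +
          ((63 / 64 : ℝ) ^ f) ^ (Fintype.card κ - T.card) + (63 / 64) ^ r) *
            ((2 * n).choose t : ℝ) := by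
        refine Finset.sum_le_sum fun T _ => ?_
        rw [← pow_mul, ← pow_mul]
        refine abs_krawtchouk_le ?_ ht htn hr
        rw [← mul_add, Nat.add_sub_cancel' (Finset.card_le_univ T), hn]
    _ = _ := by
        rw [← Finset.sum_mul, Finset.sum_add_distrib, Finset.sum_add_distrib, hsum, hsum']
        rw [Finset.sum_const, Finset.card_univ, Fintype.card_finset, nsmul_eq_mul]
        push_cast
        ring

/-! ### The module 𝔽₂[X]/(X^n - 1) and its annihilators. -/

/-- The cyclic shift of the coordinates of vectors indexed by `ZMod n`. -/
def cyclicShift (n : ℕ) : Module.End (ZMod 2) (ZMod n → ZMod 2) where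
  toFun u g := u (g - 1)
  map_add' _ _ := rfl
  map_smul' _ _ := rfl

/-- The action of a polynomial on vectors, the indeterminate acting as the cyclic shift. -/
noncomputable def polyAct (n : ℕ) (P : (ZMod 2)[X]) : Module.End (ZMod 2) (ZMod n → ZMod 2) :=
  aeval (cyclicShift n) P

theorem cyclicShift_pow_apply (n k : ℕ) (u : ZMod n → ZMod 2) (g : ZMod n) :
    (cyclicShift n ^ k) u g = u (g - k) := by
  induction k generalizing u with
  | zero => simp
  | succ k ih =>
    rw [pow_succ, Module.End.mul_apply, ih]
    simp [cyclicShift, sub_sub]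

theorem polyAct_X_pow (n k : ℕ) (u : ZMod n → ZMod 2) (g : ZMod n) :
    polyAct n (X ^ k) u g = u (g - k) := by
  rw [polyAct, map_pow, aeval_X, cyclicShift_pow_apply]

theorem polyAct_mul (n : ℕ) (P Q : (ZMod 2)[X]) (u : ZMod n → ZMod 2) :
    polyAct n (P * Q) u = polyAct n P (polyAct n Q u) := by
  rw [polyAct, map_mul]; rfl

theorem polyAct_add (n : ℕ) (P Q : (ZMod 2)[X]) (u : ZMod n → ZMod 2) :
    polyAct n (P + Q) u = polyAct n P u + polyAct n Q u := by
  rw [polyAct, map_add]; rfl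

theorem polyAct_sub (n : ℕ) (P Q : (ZMod 2)[X]) (u : ZMod n → ZMod 2) :
    polyAct n (P - Q) u = polyAct n P u - polyAct n Q u := by
  rw [polyAct, map_sub]; rfl

theorem polyAct_comm (n : ℕ) (P Q : (ZMod 2)[X]) (u : ZMod n → ZMod 2) :
    polyAct n P (polyAct n Q u) = polyAct n Q (polyAct n P u) := by
  rw [← polyAct_mul, mul_comm, polyAct_mul]

theorem polyAct_X_pow_sub_one_eq_zero_iff {n k : ℕ} {u : ZMod n → ZMod 2} :
    polyAct n (X ^ k - 1) u = 0 ↔ ∀ g, u (g - k) = u g := by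
  rw [polyAct_sub, sub_eq_zero, funext_iff]
  simp only [polyAct_X_pow]
  simp [polyAct]

theorem polyAct_eq_zero_of_dvd {n : ℕ} {P : (ZMod 2)[X]} (h : X ^ n - 1 ∣ P)
    (u : ZMod n → ZMod 2) : polyAct n P u = 0 := by
  obtain ⟨Q, rfl⟩ := h
  rw [polyAct_mul, polyAct_X_pow_sub_one_eq_zero_iff.2]
  simp

theorem polyAct_monomial_sum (n : ℕ) (P : (ZMod 2)[X]) (u : ZMod n → ZMod 2) (g : ZMod n) :
    polyAct n P u g = P.sum fun k c => c * u (g - k) := by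
  rw [polyAct, aeval_eq_sum_range, sum_over_range _ (by simp), LinearMap.sum_apply, Finset.sum_apply]
  refine Finset.sum_congr rfl fun k _ => ?_
  rw [LinearMap.smul_apply, Pi.smul_apply, cyclicShift_pow_apply, smul_eq_mul]

/-- The unit vector at 0 generates the cyclic module, so its annihilator is exactly the ideal of X^n
- 1: a remainder of degree less than n can be read off from its action. -/
theorem polyAct_single_eq_zero_iff {n : ℕ} [NeZero n] {P : (ZMod 2)[X]} :
    polyAct n P (Pi.single 0 1) = 0 ↔ X ^ n - 1 ∣ P := by
  refine ⟨fun h => ?_, fun h => polyAct_eq_zero_of_dvd h _⟩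
  have hmon : (X ^ n - 1 : (ZMod 2)[X]).Monic := monic_X_pow_sub_C 1 (NeZero.ne n)
  rw [← modByMonic_eq_zero_iff_dvd hmon]
  set Q := P %ₘ (X ^ n - 1) with hQ
  have hdeg : Q.natDegree < n := by
    have h1 : (X ^ n - 1 : (ZMod 2)[X]).natDegree = n := natDegree_X_pow_sub_C
    calc Q.natDegree < (X ^ n - 1 : (ZMod 2)[X]).natDegree :=
          natDegree_modByMonic_lt _ hmon (by
            intro h2
            rw [h2, natDegree_one] at h1
            exact NeZero.ne n h1.symm)
      _ = n := h1
  have hact : polyAct n Q (Pi.single 0 1) = 0 := by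
    rw [← h, hQ]
    conv_rhs => rw [← modByMonic_add_div P (X ^ n - 1)]
    rw [polyAct_add, polyAct_eq_zero_of_dvd (dvd_mul_right _ _), add_zero]
  ext k
  rw [coeff_zero]
  by_cases hk : k < n
  · have := congrFun hact (k : ZMod n)
    rw [polyAct_monomial_sum, sum_over_range' _ (by simp) n hdeg,
      Finset.sum_eq_single k] at this
    · simpa using this
    · intro j hj hjk
      rw [Pi.single_eq_of_ne, mul_zero]
      intro h0
      rw [sub_eq_zero, ZMod.natCast_eq_natCast_iff] at h0
      exact hjk (Nat.ModEq.eq_of_lt_of_lt h0 hk (Finset.mem_range.1 hj)).symm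
    · intro h1
      exact absurd (Finset.mem_range.2 hk) h1
  · exact coeff_eq_zero_of_natDegree_lt (by omega)

/-- The polynomial with coefficient vector `u`. -/
noncomputable def vecPoly {n : ℕ} [NeZero n] (u : ZMod n → ZMod 2) : (ZMod 2)[X] :=
  ∑ g : ZMod n, C (u g) * X ^ g.val

theorem vecPoly_sub {n : ℕ} [NeZero n] (u v : ZMod n → ZMod 2) :
    vecPoly (u - v) = vecPoly u - vecPoly v := by
  simp [vecPoly, sub_mul, Finset.sum_sub_distrib]

theorem polyAct_vecPoly_single {n : ℕ} [NeZero n] (u : ZMod n → ZMod 2) :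
    polyAct n (vecPoly u) (Pi.single 0 1) = u := by
  ext h
  rw [vecPoly, polyAct, map_sum, LinearMap.sum_apply, Finset.sum_apply, Finset.sum_eq_single h]
  · rw [map_mul, Module.End.mul_apply, aeval_C]
    simp [cyclicShift_pow_apply]
  · intro g _ hg
    rw [map_mul, Module.End.mul_apply, aeval_C]
    have : h - g ≠ 0 := sub_ne_zero.2 hg.symm
    simp [cyclicShift_pow_apply, this]
  · simp

/-- The cyclic convolution of two vectors, that is, the product in `𝔽₂[X] / (X ^ n - 1)`. -/
noncomputable def cyclicMul {n : ℕ} [NeZero n] (a : ZMod n → ZMod 2) :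
    Module.End (ZMod 2) (ZMod n → ZMod 2) :=
  polyAct n (vecPoly a)

theorem cyclicMul_sub_left {n : ℕ} [NeZero n] (a b u : ZMod n → ZMod 2) :
    cyclicMul (a - b) u = cyclicMul a u - cyclicMul b u := by
  rw [cyclicMul, vecPoly_sub, polyAct_sub]; rfl

theorem cyclicMul_polyAct {n : ℕ} [NeZero n] (a : ZMod n → ZMod 2) (P : (ZMod 2)[X])
    (u : ZMod n → ZMod 2) : cyclicMul a (polyAct n P u) = polyAct n P (cyclicMul a u) :=
  polyAct_comm n _ _ _

theorem cyclicMul_eq_zero_iff {n : ℕ} [NeZero n] {a u : ZMod n → ZMod 2} :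
    cyclicMul a u = 0 ↔ X ^ n - 1 ∣ vecPoly a * vecPoly u := by
  rw [← polyAct_single_eq_zero_iff, polyAct_mul, polyAct_vecPoly_single]; rfl

theorem polyAct_eq_zero_iff {n : ℕ} [NeZero n] {P : (ZMod 2)[X]} {u : ZMod n → ZMod 2} :
    polyAct n P u = 0 ↔ X ^ n - 1 ∣ P * vecPoly u := by
  rw [← polyAct_single_eq_zero_iff, polyAct_mul, polyAct_vecPoly_single]

theorem exists_eq_polyAct_of_dvd {n : ℕ} [NeZero n] {P : (ZMod 2)[X]} {u : ZMod n → ZMod 2}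
    (h : P ∣ vecPoly u) : ∃ b, u = polyAct n P b := by
  obtain ⟨Q, hQ⟩ := h
  exact ⟨polyAct n Q (Pi.single 0 1), by rw [← polyAct_mul, ← hQ, polyAct_vecPoly_single]⟩

/-- Annihilators: a vector `a` with `a * u = 0` is periodic if `u` is prime to the high cyclotomic
factors of `X ^ n - 1`. -/
theorem polyAct_eq_zero_of_cyclicMul_eq_zero {q m : ℕ} [NeZero (q ^ m)] (hq : q.Prime)
    (hirr : ∀ k, k ≠ 0 → Irreducible (cyclotomic (q ^ k) (ZMod 2))) {a u : ZMod (q ^ m) → ZMod 2}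
    (h : cyclicMul a u = 0) {i : ℕ} (him : i ≤ m)
    (hu : ∀ j, i ≤ j → j < m → ¬ ∃ b, u = polyAct (q ^ m) (cyclotomic (q ^ (j + 1)) (ZMod 2)) b) :
    polyAct (q ^ m) (X ^ q ^ i - 1) a = 0 := by
  have : Fact q.Prime := ⟨hq⟩
  rw [cyclicMul_eq_zero_iff] at h
  rw [polyAct_eq_zero_iff]
  -- Descend from m, using X^{q^{i+1}} - 1 = Φ_{q^{i+1}} (X^{q^i} - 1): the prime Φ_{q^{i+1}}
  -- divides a product and not u, so it divides the cofactor of a.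
  induction him using Nat.decreasingInduction with
  | self => exact dvd_mul_right _ _
  | of_succ i hi ih =>
    have ih := ih fun j hj hjm => hu j (by omega) hjm
    obtain ⟨G, hG⟩ : (X ^ q ^ (i + 1) - 1 : (ZMod 2)[X]) ∣ X ^ q ^ m - 1 := by
      obtain ⟨k, hk⟩ := pow_dvd_pow q hi
      rw [hk, pow_mul]
      exact sub_one_dvd_pow_sub_one _ k
    have hne : (X ^ q ^ (i + 1) - 1 : (ZMod 2)[X]) ≠ 0 :=
      (monic_X_pow_sub_C 1 (pow_ne_zero _ hq.ne_zero)).ne_zero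
    have hne' : (X ^ q ^ m - 1 : (ZMod 2)[X]) ≠ 0 :=
      (monic_X_pow_sub_C 1 (pow_ne_zero _ hq.ne_zero)).ne_zero
    have hG0 : G ≠ 0 := by rintro rfl; exact hne' (by rw [hG, mul_zero])
    rw [hG] at ih h
    obtain ⟨A, hA⟩ := (mul_dvd_mul_iff_left hne).1 ih
    have h1 : (X ^ q ^ (i + 1) - 1 : (ZMod 2)[X]) ∣ A * vecPoly u := by
      rw [hA, mul_comm _ G, mul_assoc] at h
      exact (mul_dvd_mul_iff_left hG0).1 h
    have hcyc := cyclotomic_prime_pow_mul_X_pow_sub_one (ZMod 2) q i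
    rcases (hirr (i + 1) i.succ_ne_zero).prime.dvd_or_dvd
      ((Dvd.intro _ hcyc).trans h1) with h2 | h2
    · obtain ⟨A', rfl⟩ := h2
      refine ⟨A', ?_⟩
      rw [hA, hG, ← hcyc]
      ring
    · exact absurd (exists_eq_polyAct_of_dvd h2) (hu i le_rfl hi)

theorem exists_eq_comp_castHom_of_periodic {α : Type*} {n d : ℕ} [NeZero n] (hd : d ∣ n)
    {u : ZMod n → α} (h : ∀ g, u (g - d) = u g) :
    ∃ u' : ZMod d → α, ∀ g, u g = u' (ZMod.castHom hd (ZMod d) g) := by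
  have hd0 : NeZero d := ⟨fun h0 => NeZero.ne n (by subst h0; exact Nat.eq_zero_of_zero_dvd hd)⟩
  refine ⟨fun c => u (c.val : ZMod n), fun g => ?_⟩
  have key : ∀ k r : ℕ, u ((d * k + r : ℕ) : ZMod n) = u (r : ZMod n) := by
    intro k r
    induction k with
    | zero => simp
    | succ k ih =>
      rw [← ih, ← h]
      congr 1
      push_cast
      ring
  have h1 : (ZMod.castHom hd (ZMod d) g).val = g.val % d := by
    conv_lhs => rw [← ZMod.natCast_zmod_val g, map_natCast, ZMod.val_natCast]
  beta_reduce
  rw [h1]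
  conv_lhs => rw [← ZMod.natCast_zmod_val g, ← Nat.div_add_mod g.val d]
  exact key _ _

theorem card_periodic_le {n d : ℕ} [NeZero n] (hd : d ∣ n) :
    ({u : ZMod n → ZMod 2 | ∀ g, u (g - d) = u g} : Finset _).card ≤ 2 ^ d := by
  have hd0 : NeZero d := ⟨fun h0 => NeZero.ne n (by subst h0; exact Nat.eq_zero_of_zero_dvd hd)⟩
  have hsub : ({u : ZMod n → ZMod 2 | ∀ g, u (g - d) = u g} : Finset _) ⊆
      Finset.univ.image fun (u' : ZMod d → ZMod 2) (g : ZMod n) =>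
        u' (ZMod.castHom hd (ZMod d) g) := by
    intro u hu
    obtain ⟨u', h⟩ := exists_eq_comp_castHom_of_periodic hd (Finset.mem_filter.1 hu).2
    exact Finset.mem_image.2 ⟨u', Finset.mem_univ _, (funext h).symm⟩
  refine (Finset.card_le_card hsub).trans (Finset.card_image_le.trans ?_)
  simp [ZMod.card]

/-- The number of solutions `a` of `a * u = v`. -/
theorem card_cyclicMul_eq_le {q m : ℕ} [NeZero (q ^ m)] (hq : q.Prime)
    (hirr : ∀ k, k ≠ 0 → Irreducible (cyclotomic (q ^ k) (ZMod 2))) (u v : ZMod (q ^ m) → ZMod 2)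
    {i : ℕ} (him : i ≤ m)
    (hu : ∀ j, i ≤ j → j < m → ¬ ∃ b, u = polyAct (q ^ m) (cyclotomic (q ^ (j + 1)) (ZMod 2)) b) :
    ({a | cyclicMul a u = v} : Finset (ZMod (q ^ m) → ZMod 2)).card ≤ 2 ^ q ^ i := by
  classical
  rcases Finset.eq_empty_or_nonempty ({a | cyclicMul a u = v} : Finset (ZMod (q ^ m) → ZMod 2))
    with h | ⟨a₀, h₀⟩
  · rw [h]; simp
  refine le_trans ?_ (card_periodic_le (pow_dvd_pow q him))
  -- Two solutions differ by an annihilator of u, which has period q^i.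
  refine Finset.card_le_card_of_injOn (fun a => a - a₀) ?_ fun a _ b _ hab => by simpa using hab
  intro a ha
  simp only [Finset.coe_filter, Finset.mem_univ, true_and, Set.mem_ofPred_eq,
    Finset.mem_filter] at ha h₀ ⊢
  rw [← polyAct_X_pow_sub_one_eq_zero_iff]
  refine polyAct_eq_zero_of_cyclicMul_eq_zero hq hirr ?_ him hu
  rw [cyclicMul_sub_left, ha, h₀, sub_self]

/-! ### Passage between the lengths n and d for d dividing n. -/

/-- Summation of coordinates over the fibres of `ZMod n → ZMod d`. -/
def fold {n d : ℕ} [NeZero n] (hd : d ∣ n) : (ZMod n → ZMod 2) →ₗ[ZMod 2] (ZMod d → ZMod 2) where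
  toFun := fiberSum (ZMod.castHom hd (ZMod d))
  map_add' u v := by ext c; simp [fiberSum, Finset.sum_add_distrib]
  map_smul' r u := by ext c; simp [fiberSum, Finset.mul_sum]

theorem fold_cyclicShift {n d : ℕ} [NeZero n] (hd : d ∣ n) (u : ZMod n → ZMod 2) :
    fold hd (cyclicShift n u) = cyclicShift d (fold hd u) := by
  ext c
  simp only [fold, LinearMap.coe_mk, AddHom.coe_mk, fiberSum, cyclicShift]
  refine Finset.sum_nbij' (fun g => g - 1) (fun g => g + 1) ?_ ?_ ?_ ?_ ?_
  · intro g hg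
    simp only [Finset.mem_filter, Finset.mem_univ, true_and] at hg ⊢
    rw [map_sub, hg, map_one]
  · intro g hg
    simp only [Finset.mem_filter, Finset.mem_univ, true_and] at hg ⊢
    rw [map_add, hg, map_one, sub_add_cancel]
  · simp
  · simp
  · simp

/-- The pullback of vectors along `ZMod n → ZMod d`. -/
def pullback {n d : ℕ} (hd : d ∣ n) : (ZMod d → ZMod 2) →ₗ[ZMod 2] (ZMod n → ZMod 2) where
  toFun u g := u (ZMod.castHom hd (ZMod d) g)
  map_add' _ _ := rfl
  map_smul' _ _ := rfl

theorem map_polyAct {n d : ℕ} (L : (ZMod n → ZMod 2) →ₗ[ZMod 2] (ZMod d → ZMod 2))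
    (hL : ∀ u, L (cyclicShift n u) = cyclicShift d (L u)) (P : (ZMod 2)[X])
    (u : ZMod n → ZMod 2) : L (polyAct n P u) = polyAct d P (L u) := by
  have hpow : ∀ (k : ℕ) u, L ((cyclicShift n ^ k) u) = (cyclicShift d ^ k) (L u) := by
    intro k
    induction k with
    | zero => simp
    | succ k ih => intro u; rw [pow_succ, Module.End.mul_apply, ih, hL, pow_succ]; rfl
  rw [polyAct, polyAct, aeval_eq_sum_range, aeval_eq_sum_range,
    LinearMap.sum_apply, LinearMap.sum_apply, map_sum]
  refine Finset.sum_congr rfl fun k _ => ?_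
  rw [LinearMap.smul_apply, LinearMap.smul_apply, map_smul, hpow]

theorem fold_polyAct {n d : ℕ} [NeZero n] (hd : d ∣ n) (P : (ZMod 2)[X]) (u : ZMod n → ZMod 2) :
    fold hd (polyAct n P u) = polyAct d P (fold hd u) :=
  map_polyAct _ (fold_cyclicShift hd) P u

theorem pullback_polyAct {n d : ℕ} (hd : d ∣ n) (P : (ZMod 2)[X]) (u : ZMod d → ZMod 2) :
    pullback hd (polyAct d P u) = polyAct n P (pullback hd u) :=
  map_polyAct _ (fun u => by
    ext g
    change u (ZMod.castHom hd (ZMod d) g - 1) = u (ZMod.castHom hd (ZMod d) (g - 1))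
    rw [map_sub, map_one]) P u

theorem fold_single {n d : ℕ} [NeZero n] (hd : d ∣ n) :
    fold hd (Pi.single 0 1) = Pi.single 0 1 := by
  ext c
  simp only [fold, LinearMap.coe_mk, AddHom.coe_mk, fiberSum]
  rw [Finset.sum_filter, Finset.sum_eq_single 0]
  · rw [map_zero, Pi.single_eq_same, Pi.single_apply]
    simp [eq_comm]
  · intro g _ hg
    simp [Pi.single_eq_of_ne hg]
  · simp

/-- The polynomials of a and of its fold agree modulo X^d - 1, which annihilates vectors of period
d. -/
theorem cyclicMul_pullback {n d : ℕ} [NeZero n] [NeZero d] (hd : d ∣ n) (a : ZMod n → ZMod 2)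
    (u : ZMod d → ZMod 2) :
    cyclicMul a (pullback hd u) = pullback hd (cyclicMul (fold hd a) u) := by
  rw [cyclicMul, ← pullback_polyAct, cyclicMul]
  congr 1
  rw [← sub_eq_zero, ← polyAct_sub]
  refine polyAct_eq_zero_of_dvd ?_ u
  rw [← polyAct_single_eq_zero_iff, polyAct_sub, polyAct_vecPoly_single, ← fold_single hd,
    ← fold_polyAct, polyAct_vecPoly_single, sub_self]

/-- The fold is still a multiple of Φ_{q^{j+1}}, and (X^{q^j} - 1) Φ_{q^{j+1}} = X^{q^{j+1}} - 1
vanishes at length q^{j+1}. -/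
theorem fold_periodic {q m j : ℕ} [NeZero (q ^ m)] (hq : q.Prime) (hj : j + 1 ≤ m)
    {u : ZMod (q ^ m) → ZMod 2}
    (hu : ∃ b, u = polyAct (q ^ m) (cyclotomic (q ^ (j + 1)) (ZMod 2)) b)
    (c : ZMod (q ^ (j + 1))) :
    fold (pow_dvd_pow q hj) u (c - (q ^ j : ℕ)) = fold (pow_dvd_pow q hj) u c := by
  have : Fact q.Prime := ⟨hq⟩
  obtain ⟨b, rfl⟩ := hu
  revert c
  rw [← polyAct_X_pow_sub_one_eq_zero_iff, fold_polyAct, ← polyAct_mul, mul_comm,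
    cyclotomic_prime_pow_mul_X_pow_sub_one]
  exact polyAct_eq_zero_of_dvd dvd_rfl _

/-! ### Weights, balls and pairs of vectors. -/

theorem card_hammingNorm_eq {ι : Type*} [Fintype ι] [DecidableEq ι] (t : ℕ) :
    ({x : ι → ZMod 2 | hammingNorm x = t} : Finset _).card = (Fintype.card ι).choose t := by
  have h := sum_hammingNorm_eq_prod (fun _ : ι => 1) t
  have e : (1 + C (1 : ℝ) * X) = 1 + X := by simp
  rw [Finset.prod_const, e, Finset.card_univ, coeff_one_add_X_pow] at h
  simp only [ite_self, Finset.prod_const_one, Finset.sum_const, nsmul_eq_mul, mul_one] at h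
  exact_mod_cast h

/-- The nonzero binary vectors indexed by `ι` of Hamming weight at most `w`. -/
def weightBall (ι : Type*) [Fintype ι] [DecidableEq ι] (w : ℕ) : Finset (ι → ZMod 2) :=
  {x | x ≠ 0 ∧ hammingNorm x ≤ w}

theorem mem_weightBall {ι : Type*} [Fintype ι] [DecidableEq ι] {w : ℕ} {x : ι → ZMod 2} :
    x ∈ weightBall ι w ↔ x ≠ 0 ∧ hammingNorm x ≤ w := by
  simp [weightBall]

theorem hammingNorm_comp_equiv {ι κ : Type*} [Fintype ι] [Fintype κ] (e : ι ≃ κ)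
    (x : κ → ZMod 2) : hammingNorm (x ∘ e) = hammingNorm x := by
  rw [hammingNorm, hammingNorm]
  exact Finset.card_equiv e (by simp)

theorem card_weightBall_congr {ι κ : Type*} [Fintype ι] [DecidableEq ι] [Fintype κ]
    [DecidableEq κ] (e : ι ≃ κ) (w : ℕ) : (weightBall ι w).card = (weightBall κ w).card := by
  refine (Finset.card_equiv (e.symm.arrowCongr (Equiv.refl _)) fun x => ?_).symm
  have h1 : (e.symm.arrowCongr (Equiv.refl (ZMod 2))) x = x ∘ e := rfl
  have h2 : x ∘ e = 0 ↔ x = 0 := by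
    refine ⟨fun h => ?_, fun h => by rw [h]; rfl⟩
    ext k
    simpa using congrFun h (e.symm k)
  rw [mem_weightBall, mem_weightBall, h1, hammingNorm_comp_equiv, Ne, Ne, h2]

theorem hammingNorm_sumElim {ι κ : Type*} [Fintype ι] [Fintype κ] (u : ι → ZMod 2)
    (v : κ → ZMod 2) : hammingNorm (Sum.elim u v) = hammingNorm u + hammingNorm v := by
  simp only [hammingNorm, Finset.card_filter]
  rw [Fintype.sum_sum_type]
  rfl

theorem card_castHom_fiber {n d f : ℕ} [NeZero n] (hd : d ∣ n) (hf : n = f * d) (c : ZMod d) :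
    ({g : ZMod n | ZMod.castHom hd (ZMod d) g = c} : Finset _).card = f := by
  have hd0 : NeZero d := ⟨fun h0 => NeZero.ne n (by rw [hf, h0, mul_zero])⟩
  have hall : ∀ c c' : ZMod d, ({g : ZMod n | ZMod.castHom hd (ZMod d) g = c} : Finset _).card =
      ({g : ZMod n | ZMod.castHom hd (ZMod d) g = c'} : Finset _).card := by
    intro c c'
    obtain ⟨b, hb⟩ := ZMod.castHom_surjective hd (c' - c)
    refine Finset.card_equiv (Equiv.addRight b) fun g => ?_
    simp only [Finset.mem_filter, Finset.mem_univ, true_and, Equiv.coe_addRight]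
    rw [map_add, hb]
    constructor
    · rintro rfl; ring
    · intro h
      linear_combination h
  have hsum := Finset.card_eq_sum_card_fiberwise (s := (Finset.univ : Finset (ZMod n)))
    (t := Finset.univ) (f := ZMod.castHom hd (ZMod d)) (by intro; simp)
  rw [Finset.sum_congr rfl fun c' _ => hall c' c, Finset.sum_const, Finset.card_univ,
    Finset.card_univ, ZMod.card, ZMod.card, smul_eq_mul] at hsum
  refine Nat.eq_of_mul_eq_mul_left (Nat.pos_of_ne_zero hd0.ne) ?_
  rw [← hsum, mul_comm, ← hf]

/-- Reduction of the index on both halves of a vector of length `2 * n`. -/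
def castPair {n d : ℕ} (hd : d ∣ n) : ZMod n ⊕ ZMod n → ZMod d ⊕ ZMod d :=
  Sum.map (ZMod.castHom hd (ZMod d)) (ZMod.castHom hd (ZMod d))

theorem card_castPair_fiber {n d f : ℕ} [NeZero n] (hd : d ∣ n) (hf : n = f * d)
    (c : ZMod d ⊕ ZMod d) :
    ({g | castPair hd g = c} : Finset (ZMod n ⊕ ZMod n)).card = f := by
  rw [Finset.card_filter, Fintype.sum_sum_type]
  cases c with
  | inl c =>
    rw [← card_castHom_fiber hd hf c, Finset.card_filter]
    simp only [castPair, Sum.map_inl, Sum.map_inr, Sum.inl.injEq, reduceCtorEq, if_false,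
      Finset.sum_const_zero, add_zero]
  | inr c =>
    rw [← card_castHom_fiber hd hf c, Finset.card_filter]
    simp only [castPair, Sum.map_inl, Sum.map_inr, Sum.inr.injEq, reduceCtorEq, if_false,
      Finset.sum_const_zero, zero_add]

theorem fiberSum_castPair_inl {n d : ℕ} [NeZero n] (hd : d ∣ n) (x : ZMod n ⊕ ZMod n → ZMod 2)
    (c : ZMod d) : fiberSum (castPair hd) x (Sum.inl c) = fold hd (x ∘ Sum.inl) c := by
  change _ = fiberSum _ _ _
  rw [fiberSum, fiberSum, Finset.sum_filter, Finset.sum_filter, Fintype.sum_sum_type]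
  simp only [castPair, Sum.map_inl, Sum.map_inr, Sum.inl.injEq, reduceCtorEq, if_false,
    Finset.sum_const_zero, add_zero, Function.comp_apply]

theorem fiberSum_castPair_inr {n d : ℕ} [NeZero n] (hd : d ∣ n) (x : ZMod n ⊕ ZMod n → ZMod 2)
    (c : ZMod d) : fiberSum (castPair hd) x (Sum.inr c) = fold hd (x ∘ Sum.inr) c := by
  change _ = fiberSum _ _ _
  rw [fiberSum, fiberSum, Finset.sum_filter, Finset.sum_filter, Fintype.sum_sum_type]
  simp only [castPair, Sum.map_inl, Sum.map_inr, Sum.inr.injEq, reduceCtorEq, if_false,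
    Finset.sum_const_zero, zero_add, Function.comp_apply]

/-! ### Rarity of pairs with a common cyclotomic factor. -/

/-- Divisibility by the cyclotomic polynomial of index `q ^ (j + 1)`. -/
def CyclotomicDvd (q m j : ℕ) (u : ZMod (q ^ m) → ZMod 2) : Prop :=
  ∃ b, u = polyAct (q ^ m) (cyclotomic (q ^ (j + 1)) (ZMod 2)) b

theorem CyclotomicDvd.cyclicMul {q m j : ℕ} [NeZero (q ^ m)] {u : ZMod (q ^ m) → ZMod 2}
    (h : CyclotomicDvd q m j u) (a : ZMod (q ^ m) → ZMod 2) :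
    CyclotomicDvd q m j (cyclicMul a u) := by
  obtain ⟨b, rfl⟩ := h
  exact ⟨_, cyclicMul_polyAct _ _ _⟩

open Classical in
-- Both folds have period q^j, so at most 4^{q^j} of the 4^{q^{j+1}} possible fold pairs occur; the
-- Fourier bound applies to each. The constant 6048 = 32 · 189 makes r = 189 q^{m-1} admissible
-- there.
theorem four_pow_mul_card_cyclotomicDvd_le {q m j t : ℕ} [NeZero (q ^ m)] (hq : q.Prime)
    (hq' : 6048 ≤ q) (hj : j + 1 ≤ m) (ht : q ^ m < 8 * t) (htn : t < q ^ m) :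
    (4 : ℝ) ^ q ^ (j + 1) * ({x : ZMod (q ^ m) ⊕ ZMod (q ^ m) → ZMod 2 | hammingNorm x = t ∧
        CyclotomicDvd q m j (x ∘ Sum.inl) ∧ CyclotomicDvd q m j (x ∘ Sum.inr)} : Finset _).card ≤
      4 ^ q ^ j * ((2 * (1 + (63 / 64 : ℝ) ^ q ^ (m - (j + 1))) ^ (2 * q ^ (j + 1)) +
        4 ^ q ^ (j + 1) * (63 / 64 : ℝ) ^ (189 * q ^ (m - 1))) * (2 * q ^ m).choose t) := by
  have hd0 : NeZero (q ^ (j + 1)) := ⟨pow_ne_zero _ hq.ne_zero⟩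
  have hd : q ^ (j + 1) ∣ q ^ m := pow_dvd_pow q hj
  have hdd : q ^ j ∣ q ^ (j + 1) := pow_dvd_pow q j.le_succ
  set Per : Finset (ZMod (q ^ (j + 1)) → ZMod 2) := {u | ∀ g, u (g - (q ^ j : ℕ)) = u g} with hPer
  have hPerc : Per.card ≤ 2 ^ q ^ j := card_periodic_le hdd
  set V := (Per ×ˢ Per).image (fun y => Sum.elim y.1 y.2) with hV
  have hVc : (V.card : ℝ) ≤ 4 ^ q ^ j := by
    have : V.card ≤ 2 ^ q ^ j * 2 ^ q ^ j := by
      refine Finset.card_image_le.trans ?_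
      rw [Finset.card_product]
      exact Nat.mul_le_mul hPerc hPerc
    calc (V.card : ℝ) ≤ ((2 ^ q ^ j * 2 ^ q ^ j : ℕ) : ℝ) := by exact_mod_cast this
      _ = 4 ^ q ^ j := by push_cast; rw [← mul_pow]; norm_num
  set S : Finset (ZMod (q ^ m) ⊕ ZMod (q ^ m) → ZMod 2) := {x | hammingNorm x = t ∧
        CyclotomicDvd q m j (x ∘ Sum.inl) ∧ CyclotomicDvd q m j (x ∘ Sum.inr)} with hS
  have hmaps : ∀ x ∈ S, fiberSum (castPair hd) x ∈ V := by
    intro x hx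
    obtain ⟨-, h1, h2⟩ := (Finset.mem_filter.1 hx).2
    refine Finset.mem_image.2 ⟨(fold hd (x ∘ Sum.inl), fold hd (x ∘ Sum.inr)), ?_, ?_⟩
    · rw [Finset.mem_product, hPer]
      simp only [Finset.mem_filter, Finset.mem_univ, true_and]
      exact ⟨fold_periodic hq hj h1, fold_periodic hq hj h2⟩
    · ext c
      cases c with
      | inl c => rw [fiberSum_castPair_inl]; rfl
      | inr c => rw [fiberSum_castPair_inr]; rfl
  have hcardκ : Fintype.card (ZMod (q ^ (j + 1)) ⊕ ZMod (q ^ (j + 1))) = 2 * q ^ (j + 1) := by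
    rw [Fintype.card_sum, ZMod.card, two_mul]
  have hfm : q ^ m = q ^ (m - (j + 1)) * q ^ (j + 1) := by
    rw [← pow_add, Nat.sub_add_cancel hj]
  have h32 : 32 * (189 * q ^ (m - 1)) ≤ q ^ m := by
    calc 32 * (189 * q ^ (m - 1)) = 6048 * q ^ (m - 1) := by ring
      _ ≤ q * q ^ (m - 1) := Nat.mul_le_mul_right _ hq'
      _ = q ^ m := by rw [← pow_succ', Nat.sub_add_cancel (by omega)]
  have h4 : (2 : ℝ) ^ (2 * q ^ (j + 1)) = 4 ^ q ^ (j + 1) := by rw [pow_mul]; norm_num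
  set K := (2 * (1 + (63 / 64 : ℝ) ^ q ^ (m - (j + 1))) ^ (2 * q ^ (j + 1)) +
        4 ^ q ^ (j + 1) * (63 / 64 : ℝ) ^ (189 * q ^ (m - 1))) * (2 * q ^ m).choose t with hK
  have hK0 : 0 ≤ K := by positivity
  calc (4 : ℝ) ^ q ^ (j + 1) * (S.card : ℝ)
      = ∑ z ∈ V, (4 : ℝ) ^ q ^ (j + 1) *
          (({x ∈ S | fiberSum (castPair hd) x = z} : Finset _).card : ℝ) := by
        rw [← Finset.mul_sum, Finset.card_eq_sum_card_fiberwise hmaps]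
        push_cast
        rfl
    _ ≤ ∑ z ∈ V, K := by
        refine Finset.sum_le_sum fun z _ => ?_
        have h := two_pow_mul_card_fiberSum_le_choose (castPair hd)
          (card_castPair_fiber hd hfm) (n := q ^ m) (r := 189 * q ^ (m - 1)) (t := t)
          (by rw [hcardκ, hfm]; ring) ht htn h32 z
        rw [hcardκ, h4] at h
        refine le_trans ?_ h
        gcongr
        intro x hx
        simp only [hS, Finset.mem_filter, Finset.mem_univ, true_and] at hx ⊢
        exact ⟨hx.1.1, hx.2⟩
    _ ≤ 4 ^ q ^ j * K := by
        rw [Finset.sum_const, nsmul_eq_mul]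
        gcongr

theorem pow_63_div_64_le (k : ℕ) : (63 / 64 : ℝ) ^ (63 * k) ≤ (1 / 2) ^ k := by
  rw [pow_mul]
  gcongr
  norm_num

/-- Since (63/64)^63 ≤ 1/2, the base (1 + (63/64)^f)^2 is at most 25/16 < 2, and the spare (32/25)^d
absorbs 8^d'. In the other term (63/64)^(189 n') ≤ 2^(-3n') ≤ 2^(-d - 3d'). -/
theorem weight_factor_le {d' d f n' : ℕ} (hd : 6048 * d' ≤ d) (hdn : d ≤ n') (hf : 126 ≤ f) :
    (4 : ℝ) ^ d' * (2 * (1 + (63 / 64 : ℝ) ^ f) ^ (2 * d) + 4 ^ d * (63 / 64 : ℝ) ^ (189 * n')) ≤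
      2 ^ d * (3 * (1 / 2) ^ d') := by
  have h1 : (63 / 64 : ℝ) ^ f ≤ 1 / 4 := by
    calc (63 / 64 : ℝ) ^ f ≤ (63 / 64 : ℝ) ^ (63 * 2) :=
          pow_le_pow_of_le_one (by norm_num) (by norm_num) hf
      _ ≤ (1 / 2) ^ 2 := pow_63_div_64_le 2
      _ = 1 / 4 := by norm_num
  have h2 : (1 + (63 / 64 : ℝ) ^ f) ^ (2 * d) ≤ (25 / 16) ^ d := by
    rw [pow_mul]
    have : (1 + (63 / 64 : ℝ) ^ f) ^ 2 ≤ (1 + 1 / 4) ^ 2 := by gcongr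
    refine pow_le_pow_left₀ (by positivity) (this.trans (by norm_num)) d
  have h3 : (8 : ℝ) ^ d' ≤ (32 / 25) ^ d := by
    calc (8 : ℝ) ^ d' ≤ ((32 / 25) ^ 10) ^ d' := by gcongr; norm_num
      _ = (32 / 25) ^ (10 * d') := by rw [pow_mul]
      _ ≤ _ := pow_le_pow_right₀ (by norm_num) (by omega)
  have h4 : (4 : ℝ) ^ d' * (25 / 16) ^ d ≤ 2 ^ d * (1 / 2) ^ d' := by
    have e1 : (4 : ℝ) ^ d' = 8 ^ d' * (1 / 2) ^ d' := by rw [← mul_pow]; norm_num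
    have e2 : (2 : ℝ) ^ d = (32 / 25) ^ d * (25 / 16) ^ d := by rw [← mul_pow]; norm_num
    rw [e1, e2]
    calc (8 : ℝ) ^ d' * (1 / 2) ^ d' * (25 / 16) ^ d
        = 8 ^ d' * ((1 / 2) ^ d' * (25 / 16) ^ d) := by ring
      _ ≤ (32 / 25) ^ d * ((1 / 2) ^ d' * (25 / 16) ^ d) := by gcongr
      _ = _ := by ring
  have h5 : (4 : ℝ) ^ d' * (4 ^ d * (63 / 64 : ℝ) ^ (189 * n')) ≤ 2 ^ d * (1 / 2) ^ d' := by
    have e0 : (63 / 64 : ℝ) ^ (189 * n') ≤ (1 / 2) ^ (3 * n') := by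
      rw [show 189 * n' = 63 * (3 * n') by ring]
      exact pow_63_div_64_le _
    have e1 : (1 / 2 : ℝ) ^ (3 * n') ≤ (1 / 2) ^ (d + 3 * d') :=
      pow_le_pow_of_le_one (by norm_num) (by norm_num) (by omega)
    have e2 : (4 : ℝ) ^ d = 2 ^ d * 2 ^ d := by rw [← mul_pow]; norm_num
    have e3 : (4 : ℝ) ^ d' = 2 ^ d' * 2 ^ d' := by rw [← mul_pow]; norm_num
    have e4 : (1 / 2 : ℝ) ^ (d + 3 * d') = (1 / 2) ^ d * ((1 / 2) ^ d' * (1 / 2) ^ d' *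
      (1 / 2) ^ d') := by rw [pow_add, mul_comm 3, pow_mul]; ring
    have e5 : ∀ k : ℕ, (2 : ℝ) ^ k * (1 / 2) ^ k = 1 := fun k => by rw [← mul_pow]; norm_num
    calc (4 : ℝ) ^ d' * (4 ^ d * (63 / 64 : ℝ) ^ (189 * n'))
        ≤ 4 ^ d' * (4 ^ d * (1 / 2) ^ (d + 3 * d')) := by gcongr; exact e0.trans e1
      _ = 2 ^ d * (1 / 2) ^ d' * ((2 ^ d * (1 / 2) ^ d) * (2 ^ d' * (1 / 2) ^ d') *
          (2 ^ d' * (1 / 2) ^ d')) := by rw [e2, e3, e4]; ring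
      _ = _ := by rw [e5, e5]; ring
  calc _ = 2 * (4 ^ d' * (1 + (63 / 64 : ℝ) ^ f) ^ (2 * d)) +
        4 ^ d' * (4 ^ d * (63 / 64 : ℝ) ^ (189 * n')) := by ring
    _ ≤ 2 * (4 ^ d' * (25 / 16) ^ d) + 4 ^ d' * (4 ^ d * (63 / 64 : ℝ) ^ (189 * n')) := by gcongr
    _ ≤ 2 * (2 ^ d * (1 / 2) ^ d') + 2 ^ d * (1 / 2) ^ d' := by gcongr
    _ = _ := by ring

open Classical in
theorem two_pow_mul_card_cyclotomicDvd_le {q m j t : ℕ} [NeZero (q ^ m)] (hq : q.Prime)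
    (hq' : 6048 ≤ q) (hj : j + 1 < m) (ht : q ^ m < 8 * t) (htn : t < q ^ m) :
    (2 : ℝ) ^ q ^ (j + 1) * ({x : ZMod (q ^ m) ⊕ ZMod (q ^ m) → ZMod 2 | hammingNorm x = t ∧
        CyclotomicDvd q m j (x ∘ Sum.inl) ∧ CyclotomicDvd q m j (x ∘ Sum.inr)} : Finset _).card ≤
      3 * (1 / 2) ^ q ^ j * (2 * q ^ m).choose t := by
  have h := four_pow_mul_card_cyclotomicDvd_le hq hq' hj.le ht htn
  have hw := weight_factor_le (d' := q ^ j) (d := q ^ (j + 1)) (f := q ^ (m - (j + 1)))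
    (n' := q ^ (m - 1)) (by rw [pow_succ']; exact Nat.mul_le_mul_right _ hq')
    (Nat.pow_le_pow_right hq.pos (by omega))
    (le_trans (by omega) (Nat.le_self_pow (by omega) q))
  have h2 : (4 : ℝ) ^ q ^ (j + 1) = 2 ^ q ^ (j + 1) * 2 ^ q ^ (j + 1) := by
    rw [← mul_pow]; norm_num
  refine le_of_mul_le_mul_left ?_ (show (0 : ℝ) < 2 ^ q ^ (j + 1) by positivity)
  rw [← mul_assoc, ← h2]
  refine h.trans ?_
  rw [← mul_assoc]
  calc _ ≤ 2 ^ q ^ (j + 1) * (3 * (1 / 2) ^ q ^ j) * ((2 * q ^ m).choose t : ℝ) := by gcongr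
    _ = _ := by ring

/-- The binary vectors of length `2 * n` of weight at most `n / 8`. -/
def lowWeight (n : ℕ) [NeZero n] : Finset (ZMod n ⊕ ZMod n → ZMod 2) := {x | 8 * hammingNorm x ≤ n}

/-- Chernoff bound with weight (1/8)^{wt x}, using 8 · (9/8)^16 ≤ 64. Thus there are at most
2^(3n/4) such vectors; the eighth power avoids fractional exponents. This crude count serves where
the Krawtchouk bound fails. -/
theorem card_lowWeight_pow_le (n : ℕ) [NeZero n] : ((lowWeight n).card : ℝ) ^ 8 ≤ 64 ^ n := by
  have hterm : ∀ x : ZMod n ⊕ ZMod n → ZMod 2,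
      ∏ i, (if x i = 0 then (1 : ℝ) else 1 / 8) = (1 / 8) ^ hammingNorm x := by
    intro x
    rw [Finset.prod_ite, Finset.prod_const_one, one_mul, Finset.prod_const]
    rfl
  have hsum : ∑ x : ZMod n ⊕ ZMod n → ZMod 2, (1 / 8 : ℝ) ^ hammingNorm x = (9 / 8) ^ (2 * n) := by
    simp_rw [← hterm]
    have h := Finset.prod_univ_sum (fun _ : ZMod n ⊕ ZMod n => (Finset.univ : Finset (ZMod 2)))
      (fun _ b => if b = 0 then (1 : ℝ) else 1 / 8)
    rw [Fintype.piFinset_univ] at h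
    rw [← h, Finset.prod_const, show (Finset.univ : Finset (ZMod 2)) = {0, 1} by decide,
      Finset.sum_pair (by decide), Finset.card_univ, Fintype.card_sum, ZMod.card, ← two_mul]
    norm_num
  have h1 : ((lowWeight n).card : ℝ) * (1 / 8) ^ (n / 8) ≤ (9 / 8) ^ (2 * n) := by
    rw [← hsum, ← nsmul_eq_mul, ← Finset.sum_const]
    refine (Finset.sum_le_sum fun x hx => ?_).trans
      (Finset.sum_le_sum_of_subset_of_nonneg (Finset.subset_univ _) fun _ _ _ => by positivity)
    refine pow_le_pow_of_le_one (by norm_num) (by norm_num) ?_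
    have := (Finset.mem_filter.1 hx).2
    omega
  have h2 : ((lowWeight n).card : ℝ) ≤ 8 ^ (n / 8) * (9 / 8) ^ (2 * n) := by
    have e : (8 : ℝ) ^ (n / 8) * (1 / 8) ^ (n / 8) = 1 := by rw [← mul_pow]; norm_num
    calc ((lowWeight n).card : ℝ) = 8 ^ (n / 8) * ((lowWeight n).card * (1 / 8) ^ (n / 8)) := by
          rw [mul_left_comm, e, mul_one]
      _ ≤ _ := by gcongr
  calc ((lowWeight n).card : ℝ) ^ 8 ≤ (8 ^ (n / 8) * (9 / 8) ^ (2 * n)) ^ 8 := by gcongr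
    _ = 8 ^ (n / 8 * 8) * ((9 / 8) ^ 16) ^ n := by
        rw [mul_pow, ← pow_mul, ← pow_mul, ← pow_mul]; congr 2; ring
    _ ≤ 8 ^ n * 8 ^ n := by
        gcongr
        · norm_num
        · omega
        · norm_num
    _ = 64 ^ n := by rw [← mul_pow]; norm_num

open Classical in
theorem two_pow_mul_card_ball_cyclotomicDvd_le {q k j w : ℕ} [NeZero (q ^ (k + 1))] (hq : q.Prime)
    (hq' : 6048 ≤ q) (hj : j < k) (hw : w < q ^ (k + 1)) :
    (2 : ℝ) ^ q ^ (j + 1) * ({x ∈ weightBall (ZMod (q ^ (k + 1)) ⊕ ZMod (q ^ (k + 1))) w |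
        CyclotomicDvd q (k + 1) j (x ∘ Sum.inl) ∧ CyclotomicDvd q (k + 1) j (x ∘ Sum.inr)} :
          Finset _).card ≤
      2 ^ q ^ k * (lowWeight (q ^ (k + 1))).card +
        3 * (1 / 2) ^ q ^ j * (weightBall (ZMod (q ^ (k + 1)) ⊕ ZMod (q ^ (k + 1))) w).card := by
  set n := q ^ (k + 1) with hn
  set D : (ZMod n ⊕ ZMod n → ZMod 2) → Prop := fun x =>
    CyclotomicDvd q (k + 1) j (x ∘ Sum.inl) ∧ CyclotomicDvd q (k + 1) j (x ∘ Sum.inr) with hD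
  set B := weightBall (ZMod n ⊕ ZMod n) w with hB
  set I : Finset ℕ := {t ∈ Finset.range (w + 1) | n < 8 * t} with hI
  have hsub : ({x ∈ B | D x} : Finset _) ⊆
      lowWeight n ∪ I.biUnion fun t => {x | hammingNorm x = t ∧ D x} := by
    intro x hx
    obtain ⟨hxB, hxD⟩ := Finset.mem_filter.1 hx
    rw [Finset.mem_union]
    by_cases hx8 : 8 * hammingNorm x ≤ n
    · exact Or.inl (by simpa [lowWeight] using hx8)
    · refine Or.inr (Finset.mem_biUnion.2 ⟨hammingNorm x, ?_, by simpa using hxD⟩)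
      rw [hI, Finset.mem_filter, Finset.mem_range]
      have := (mem_weightBall.1 hxB).2
      omega
  have hc : ({x ∈ B | D x} : Finset _).card ≤ (lowWeight n).card +
      ∑ t ∈ I, ({x | hammingNorm x = t ∧ D x} : Finset (ZMod n ⊕ ZMod n → ZMod 2)).card :=
    (Finset.card_le_card hsub).trans
      ((Finset.card_union_le _ _).trans (Nat.add_le_add_left Finset.card_biUnion_le _))
  have hchoose : ∑ t ∈ I, ((2 * n).choose t : ℝ) ≤ B.card := by
    have h1 : ∑ t ∈ I, (2 * n).choose t ≤ B.card := by
      have e : ∀ t, (2 * n).choose t =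
          ({x : ZMod n ⊕ ZMod n → ZMod 2 | hammingNorm x = t} : Finset _).card := by
        intro t
        rw [card_hammingNorm_eq, Fintype.card_sum, ZMod.card, two_mul]
      rw [Finset.sum_congr rfl fun t _ => e t, ← Finset.card_biUnion]
      · refine Finset.card_le_card fun x hx => ?_
        obtain ⟨t, ht, hx⟩ := Finset.mem_biUnion.1 hx
        simp only [Finset.mem_filter, Finset.mem_univ, true_and, hI, Finset.mem_range] at ht hx
        refine mem_weightBall.2 ⟨?_, by omega⟩
        rintro rfl
        rw [hammingNorm_zero] at hx
        omega
      · intro t _ t' _ htt'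
        refine Finset.disjoint_left.2 fun x hx hx' => htt' ?_
        simp only [Finset.mem_filter, Finset.mem_univ, true_and] at hx hx'
        rw [← hx, hx']
    exact_mod_cast h1
  have hle : (2 : ℝ) ^ q ^ (j + 1) ≤ 2 ^ q ^ k :=
    pow_le_pow_right₀ (by norm_num) (Nat.pow_le_pow_right hq.pos hj)
  calc (2 : ℝ) ^ q ^ (j + 1) * (({x ∈ B | D x} : Finset _).card : ℝ)
      ≤ 2 ^ q ^ (j + 1) * ((lowWeight n).card + ∑ t ∈ I,
        (({x | hammingNorm x = t ∧ D x} : Finset (ZMod n ⊕ ZMod n → ZMod 2)).card : ℝ)) := by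
        gcongr
        exact_mod_cast hc
    _ = 2 ^ q ^ (j + 1) * (lowWeight n).card + ∑ t ∈ I, (2 : ℝ) ^ q ^ (j + 1) *
        (({x | hammingNorm x = t ∧ D x} : Finset (ZMod n ⊕ ZMod n → ZMod 2)).card : ℝ) := by
        rw [mul_add, Finset.mul_sum]
    _ ≤ 2 ^ q ^ k * (lowWeight n).card + ∑ t ∈ I, 3 * (1 / 2) ^ q ^ j * ((2 * n).choose t : ℝ) := by
        refine add_le_add (by gcongr) (Finset.sum_le_sum fun t ht => ?_)
        simp only [hI, Finset.mem_filter, Finset.mem_range] at ht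
        exact two_pow_mul_card_cyclotomicDvd_le hq hq' (by omega) ht.2 (by omega)
    _ ≤ _ := by
        rw [← Finset.mul_sum]
        gcongr

/-! ### Number of multipliers sending u to v. -/

open Classical in
-- If i is the largest index below k with Φ_{q^{i+1}} dividing u, there are at most 2^{q^{i+1}}
-- solutions, one term of the sum; if no such i exists there are at most 2. A solvable v inherits
-- every cyclotomic factor of u.
theorem card_cyclicMul_eq_le_sum {q k : ℕ} [NeZero (q ^ (k + 1))] (hq : q.Prime)
    (hirr : ∀ i, i ≠ 0 → Irreducible (cyclotomic (q ^ i) (ZMod 2)))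
    (u v : ZMod (q ^ (k + 1)) → ZMod 2) (hu : polyAct (q ^ (k + 1)) (X ^ q ^ k - 1) u ≠ 0) :
    (({a | cyclicMul a u = v} : Finset (ZMod (q ^ (k + 1)) → ZMod 2)).card : ℝ) ≤
      2 + ∑ j ∈ Finset.range k, if CyclotomicDvd q (k + 1) j u ∧ CyclotomicDvd q (k + 1) j v then
        (2 : ℝ) ^ q ^ (j + 1) else 0 := by
  have : Fact q.Prime := ⟨hq⟩
  have hnn : 0 ≤ ∑ j ∈ Finset.range k, if CyclotomicDvd q (k + 1) j u ∧ CyclotomicDvd q (k + 1) j v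
      then (2 : ℝ) ^ q ^ (j + 1) else 0 :=
    Finset.sum_nonneg fun j _ => by split_ifs <;> positivity
  rcases Finset.eq_empty_or_nonempty
    ({a | cyclicMul a u = v} : Finset (ZMod (q ^ (k + 1)) → ZMod 2)) with h | ⟨a₀, h₀⟩
  · rw [h, Finset.card_empty, Nat.cast_zero]
    positivity
  have hv : cyclicMul a₀ u = v := by simpa using h₀
  -- A multiple of the top factor Φ_{q^{k+1}} is killed by X^{q^k} - 1.
  have htop : ¬ CyclotomicDvd q (k + 1) k u := by
    rintro ⟨b, rfl⟩
    refine hu ?_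
    rw [← polyAct_mul, mul_comm, cyclotomic_prime_pow_mul_X_pow_sub_one]
    exact polyAct_eq_zero_of_dvd dvd_rfl _
  rcases Finset.eq_empty_or_nonempty ({j ∈ Finset.range k | CyclotomicDvd q (k + 1) j u})
    with hS | hS
  · have hc := card_cyclicMul_eq_le hq hirr u v (i := 0) (Nat.zero_le _) (fun j _ hj hd => by
      rcases Nat.lt_succ_iff_lt_or_eq.1 hj with hjk | rfl
      · have : j ∈ ({j ∈ Finset.range k | CyclotomicDvd q (k + 1) j u}) :=
          Finset.mem_filter.2 ⟨Finset.mem_range.2 hjk, hd⟩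
        rw [hS] at this
        simp at this
      · exact htop hd)
    rw [pow_zero, pow_one] at hc
    have : (({a | cyclicMul a u = v} : Finset (ZMod (q ^ (k + 1)) → ZMod 2)).card : ℝ) ≤ 2 := by
      exact_mod_cast hc
    linarith
  · obtain ⟨i, hi, hmax⟩ := Finset.exists_max_image _ id hS
    obtain ⟨hik, hiu⟩ := Finset.mem_filter.1 hi
    have hc := card_cyclicMul_eq_le hq hirr u v (i := i + 1)
      (by have := Finset.mem_range.1 hik; omega) (fun j hij hj hd => by
        rcases Nat.lt_succ_iff_lt_or_eq.1 hj with hjk | rfl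
        · have := hmax j (Finset.mem_filter.2 ⟨Finset.mem_range.2 hjk, hd⟩)
          simp only [id] at this
          omega
        · exact htop hd)
    have hiv : CyclotomicDvd q (k + 1) i v := hv ▸ hiu.cyclicMul a₀
    have hsingle := Finset.single_le_sum
      (f := fun j => if CyclotomicDvd q (k + 1) j u ∧ CyclotomicDvd q (k + 1) j v then
        (2 : ℝ) ^ q ^ (j + 1) else 0) (fun j _ => by split_ifs <;> positivity) hik
    simp only [if_pos (And.intro hiu hiv)] at hsingle
    have hc' : (({a | cyclicMul a u = v} : Finset (ZMod (q ^ (k + 1)) → ZMod 2)).card : ℝ) ≤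
      2 ^ q ^ (i + 1) := by exact_mod_cast hc
    linarith

open Classical in
theorem sum_card_cyclicMul_eq_le {q k w : ℕ} [NeZero (q ^ (k + 1))] (hq : q.Prime)
    (hq' : 6048 ≤ q) (hirr : ∀ i, i ≠ 0 → Irreducible (cyclotomic (q ^ i) (ZMod 2)))
    (hw : w < q ^ (k + 1)) :
    ∑ x ∈ weightBall (ZMod (q ^ (k + 1)) ⊕ ZMod (q ^ (k + 1))) w with
        polyAct (q ^ (k + 1)) (X ^ q ^ k - 1) (x ∘ Sum.inl) ≠ 0,
      (({a | cyclicMul a (x ∘ Sum.inl) = x ∘ Sum.inr} :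
        Finset (ZMod (q ^ (k + 1)) → ZMod 2)).card : ℝ) ≤
      5 * (weightBall (ZMod (q ^ (k + 1)) ⊕ ZMod (q ^ (k + 1))) w).card +
        k * 2 ^ q ^ k * (lowWeight (q ^ (k + 1))).card := by
  set n := q ^ (k + 1) with hn
  set B := weightBall (ZMod n ⊕ ZMod n) w with hB
  set D : ℕ → (ZMod n ⊕ ZMod n → ZMod 2) → Prop := fun j x =>
    CyclotomicDvd q (k + 1) j (x ∘ Sum.inl) ∧ CyclotomicDvd q (k + 1) j (x ∘ Sum.inr) with hD
  have hgeom : ∑ j ∈ Finset.range k, (1 / 2 : ℝ) ^ q ^ j ≤ 1 := by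
    have h1 : ∀ j, (1 / 2 : ℝ) ^ q ^ j ≤ (1 / 2) * (1 / 2) ^ j := by
      intro j
      rw [← pow_succ']
      exact pow_le_pow_of_le_one (by norm_num) (by norm_num)
        (Nat.succ_le_of_lt (Nat.lt_pow_self hq.one_lt))
    calc _ ≤ ∑ j ∈ Finset.range k, (1 / 2 : ℝ) * (1 / 2) ^ j := Finset.sum_le_sum fun j _ => h1 j
      _ = 1 - (1 / 2) ^ k := by
          rw [← Finset.mul_sum, geom_sum_eq (by norm_num)]; ring
      _ ≤ 1 := by
          have : (0 : ℝ) ≤ (1 / 2) ^ k := by positivity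
          linarith
  calc _ ≤ ∑ x ∈ B with polyAct n (X ^ q ^ k - 1) (x ∘ Sum.inl) ≠ 0,
        (2 + ∑ j ∈ Finset.range k, if D j x then (2 : ℝ) ^ q ^ (j + 1) else 0) :=
        Finset.sum_le_sum fun x hx =>
          card_cyclicMul_eq_le_sum hq hirr _ _ (Finset.mem_filter.1 hx).2
    _ ≤ ∑ x ∈ B, (2 + ∑ j ∈ Finset.range k, if D j x then (2 : ℝ) ^ q ^ (j + 1) else 0) :=
        Finset.sum_le_sum_of_subset_of_nonneg (Finset.filter_subset _ _) fun x _ _ =>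
          add_nonneg (by norm_num) (Finset.sum_nonneg fun j _ => by split_ifs <;> positivity)
    _ = 2 * B.card + ∑ j ∈ Finset.range k,
          (2 : ℝ) ^ q ^ (j + 1) * (({x ∈ B | D j x} : Finset _).card : ℝ) := by
        rw [Finset.sum_add_distrib, Finset.sum_comm, Finset.sum_const, nsmul_eq_mul, mul_comm]
        congr 1
        refine Finset.sum_congr rfl fun j _ => ?_
        rw [← Finset.sum_filter, Finset.sum_const, nsmul_eq_mul, mul_comm]
    _ ≤ 2 * B.card + ∑ j ∈ Finset.range k,
          (2 ^ q ^ k * ((lowWeight n).card : ℝ) + 3 * (1 / 2) ^ q ^ j * B.card) := by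
        refine add_le_add le_rfl (Finset.sum_le_sum fun j hj => ?_)
        exact two_pow_mul_card_ball_cyclotomicDvd_le hq hq' (Finset.mem_range.1 hj) hw
    _ = 2 * B.card + (k * 2 ^ q ^ k * (lowWeight n).card +
          (∑ j ∈ Finset.range k, (1 / 2 : ℝ) ^ q ^ j) * (3 * B.card)) := by
        rw [Finset.sum_add_distrib, Finset.sum_const, Finset.card_range, nsmul_eq_mul,
          Finset.sum_mul]
        congr 2
        · ring
        · exact Finset.sum_congr rfl fun j _ => by ring
    _ ≤ 2 * B.card + (k * 2 ^ q ^ k * (lowWeight n).card + 1 * (3 * B.card)) := by gcongr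
    _ = _ := by ring

/-! ### Double counting with the n shifts of a word. -/

theorem exists_natCast_mul_eq_pow {q k : ℕ} (hq : q.Prime) {c : ZMod (q ^ (k + 1))} (hc : c ≠ 0) :
    ∃ s : ℕ, (s : ZMod (q ^ (k + 1))) * c = (q ^ k : ℕ) := by
  have : NeZero (q ^ (k + 1)) := ⟨pow_ne_zero _ hq.ne_zero⟩
  obtain ⟨i, hi, hgcd⟩ := (Nat.dvd_prime_pow hq).1 (Nat.gcd_dvd_right c.val (q ^ (k + 1)))
  have hik : i ≤ k := by
    by_contra hcon
    have hik : i = k + 1 := by omega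
    have hdvd : q ^ (k + 1) ∣ c.val := by
      rw [hik] at hgcd
      exact hgcd.symm.dvd.trans (Nat.gcd_dvd_left _ _)
    have h0 := Nat.eq_zero_of_dvd_of_lt hdvd (ZMod.val_lt c)
    exact hc ((ZMod.val_eq_zero c).1 h0)
  have hb := congrArg (Int.cast : ℤ → ZMod (q ^ (k + 1))) (Nat.gcd_eq_gcd_ab c.val (q ^ (k + 1)))
  rw [hgcd] at hb
  simp only [Int.cast_natCast, Int.cast_add, Int.cast_mul] at hb
  rw [ZMod.natCast_zmod_val, ZMod.natCast_self, zero_mul, add_zero] at hb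
  refine ⟨((q ^ (k - i) : ℕ) * (Nat.gcdA c.val (q ^ (k + 1)) : ZMod (q ^ (k + 1)))).val, ?_⟩
  rw [ZMod.natCast_zmod_val, mul_assoc, mul_comm _ c, ← hb, ← Nat.cast_mul, ← pow_add,
    Nat.sub_add_cancel hik]

/-- Every nontrivial subgroup of the cyclic group of order q^{k+1} contains q^k, so any nontrivial
period would force the period q^k. -/
theorem shift_injective_of_not_periodic {q k : ℕ} (hq : q.Prime)
    {u : ZMod (q ^ (k + 1)) → ZMod 2} (hu : polyAct (q ^ (k + 1)) (X ^ q ^ k - 1) u ≠ 0) :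
    Function.Injective fun (g h : ZMod (q ^ (k + 1))) => u (h - g) := by
  intro g g' hgg
  by_contra hne
  have hc : g - g' ≠ 0 := sub_ne_zero.2 hne
  have hper : ∀ h, u (h - (g - g')) = u h := by
    intro h
    have := congrFun hgg (h + g')
    beta_reduce at this
    rw [show h - (g - g') = h + g' - g by ring, this]
    ring_nf
  obtain ⟨s, hs⟩ := exists_natCast_mul_eq_pow hq hc
  refine hu (polyAct_X_pow_sub_one_eq_zero_iff.2 fun h => ?_)
  rw [← hs]
  clear hs
  induction s with
  | zero => simp
  | succ s ih =>
    rw [← ih, ← hper (h - s * (g - g'))]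
    congr 1
    push_cast
    ring

open Classical in
/-- The multipliers `a` whose double circulant code has a word of weight at most `w` without a
smaller period. -/
noncomputable def badPrimitive (q k w : ℕ) [NeZero (q ^ (k + 1))] :
    Finset (ZMod (q ^ (k + 1)) → ZMod 2) :=
  {a | ∃ u, polyAct (q ^ (k + 1)) (X ^ q ^ k - 1) u ≠ 0 ∧
    hammingNorm u + hammingNorm (cyclicMul a u) ≤ w}

theorem hammingNorm_polyAct_X_pow {n : ℕ} [NeZero n] (k : ℕ) (u : ZMod n → ZMod 2) :
    hammingNorm (polyAct n (X ^ k) u) = hammingNorm u := by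
  have : polyAct n (X ^ k) u = u ∘ Equiv.subRight (k : ZMod n) := by
    ext g
    rw [polyAct_X_pow]
    rfl
  rw [this, hammingNorm_comp_equiv]

open Classical in
-- Count incidences between words and multipliers: each bad multiplier is met by the n shifts of one
-- light word.
theorem mul_card_badPrimitive_le {q k w : ℕ} [NeZero (q ^ (k + 1))] (hq : q.Prime)
    (hq' : 6048 ≤ q) (hirr : ∀ i, i ≠ 0 → Irreducible (cyclotomic (q ^ i) (ZMod 2)))
    (hw : w < q ^ (k + 1)) :
    (q ^ (k + 1) : ℝ) * (badPrimitive q k w).card ≤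
      5 * (weightBall (ZMod (q ^ (k + 1)) ⊕ ZMod (q ^ (k + 1))) w).card +
        k * 2 ^ q ^ k * (lowWeight (q ^ (k + 1))).card := by
  refine le_trans ?_ (sum_card_cyclicMul_eq_le hq hq' hirr hw)
  set n := q ^ (k + 1) with hn
  set T : Finset (ZMod n ⊕ ZMod n → ZMod 2) := {x ∈ weightBall (ZMod n ⊕ ZMod n) w |
    polyAct n (X ^ q ^ k - 1) (x ∘ Sum.inl) ≠ 0} with hT
  have key : ∀ a ∈ badPrimitive q k w,
      n ≤ ({x ∈ T | cyclicMul a (x ∘ Sum.inl) = x ∘ Sum.inr} : Finset _).card := by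
    intro a ha
    obtain ⟨u, hu, hwt⟩ := (Finset.mem_filter.1 ha).2
    have hcard : n = (Finset.univ : Finset (ZMod n)).card := by rw [Finset.card_univ, ZMod.card]
    conv_lhs => rw [hcard]
    refine Finset.card_le_card_of_injOn (fun g => Sum.elim (polyAct n (X ^ g.val) u)
      (polyAct n (X ^ g.val) (cyclicMul a u))) ?_ ?_
    · intro g _
      have htop : polyAct n (X ^ q ^ k - 1) (polyAct n (X ^ g.val) u) ≠ 0 := by
        rw [polyAct_comm, ← hammingNorm_ne_zero_iff, hammingNorm_polyAct_X_pow]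
        exact hammingNorm_ne_zero_iff.2 hu
      have hu0 : polyAct n (X ^ g.val) u ≠ 0 := by
        intro h0
        rw [h0, map_zero] at htop
        exact htop rfl
      simp only [Finset.coe_filter, hT, Finset.mem_filter, Set.mem_ofPred_eq, mem_weightBall,
        Sum.elim_comp_inl, Sum.elim_comp_inr]
      refine ⟨⟨⟨fun h0 => hu0 ?_, ?_⟩, htop⟩, cyclicMul_polyAct _ _ _⟩
      · ext h
        exact congrFun h0 (Sum.inl h)
      · rw [hammingNorm_sumElim, hammingNorm_polyAct_X_pow, hammingNorm_polyAct_X_pow]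
        exact hwt
    · intro g _ g' _ hgg
      refine shift_injective_of_not_periodic hq hu (funext fun h => ?_)
      have := congrFun hgg (Sum.inl h)
      simpa [polyAct_X_pow] using this
  have hdouble := Finset.sum_card_bipartiteAbove_eq_sum_card_bipartiteBelow (s := T)
    (t := (Finset.univ : Finset (ZMod n → ZMod 2)))
    (fun x a => cyclicMul a (x ∘ Sum.inl) = x ∘ Sum.inr)
  have hle : n * (badPrimitive q k w).card ≤
      ∑ x ∈ T, ({a | cyclicMul a (x ∘ Sum.inl) = x ∘ Sum.inr} : Finset (ZMod n → ZMod 2)).card := by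
    calc n * (badPrimitive q k w).card = ∑ _a ∈ badPrimitive q k w, n := by
          rw [Finset.sum_const, smul_eq_mul, mul_comm]
      _ ≤ ∑ a ∈ badPrimitive q k w,
          ({x ∈ T | cyclicMul a (x ∘ Sum.inl) = x ∘ Sum.inr} : Finset _).card :=
          Finset.sum_le_sum key
      _ ≤ ∑ a : ZMod n → ZMod 2,
          ({x ∈ T | cyclicMul a (x ∘ Sum.inl) = x ∘ Sum.inr} : Finset _).card :=
          Finset.sum_le_sum_of_subset (Finset.subset_univ _)
      _ = _ := hdouble.symm
  have hle' : ((n * (badPrimitive q k w).card : ℕ) : ℝ) ≤ ((∑ x ∈ T, ({a | cyclicMul a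
      (x ∘ Sum.inl) = x ∘ Sum.inr} : Finset (ZMod n → ZMod 2)).card : ℕ) : ℝ) :=
    Nat.cast_le.2 hle
  rw [Nat.cast_mul, Nat.cast_sum] at hle'
  have hcast : (n : ℝ) = (q : ℝ) ^ (k + 1) := Nat.cast_pow q (k + 1)
  rwa [hcast] at hle'

/-! ### Periodic words and induction on the exponent. -/

open Classical in
/-- The multipliers `a` whose double circulant code has a nonzero word of weight at most `w`. -/
noncomputable def badMultiplier (n w : ℕ) [NeZero n] : Finset (ZMod n → ZMod 2) :=
  {a | ∃ u, u ≠ 0 ∧ hammingNorm u + hammingNorm (cyclicMul a u) ≤ w}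

theorem hammingNorm_pullback {n d f : ℕ} [NeZero n] [NeZero d] (hd : d ∣ n) (hf : n = f * d)
    (u : ZMod d → ZMod 2) : hammingNorm (pullback hd u) = f * hammingNorm u := by
  rw [hammingNorm, Finset.card_eq_sum_card_fiberwise (f := ZMod.castHom hd (ZMod d))
    (t := ({c | u c ≠ 0} : Finset _)), Finset.sum_congr rfl (g := fun _ => f), Finset.sum_const,
    smul_eq_mul, mul_comm]
  · rfl
  · intro c hc
    rw [← card_castHom_fiber hd hf c, Finset.filter_filter]
    congr 1
    ext g
    simp only [Finset.mem_filter, Finset.mem_univ, true_and, and_iff_right_iff_imp] at hc ⊢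
    rintro rfl
    exact hc
  · intro g hg
    exact Finset.mem_coe.2 (Finset.mem_filter.2
      ⟨Finset.mem_univ _, (Finset.mem_filter.1 (Finset.mem_coe.1 hg)).2⟩)

/-- Folding has the section σ, so (a, b) ↦ (fold a, a + σ b) is injective. -/
theorem card_preimage_fold_mul_le {n d : ℕ} [NeZero n] [NeZero d] (hd : d ∣ n)
    (S : Finset (ZMod d → ZMod 2)) :
    ({a | fold hd a ∈ S} : Finset (ZMod n → ZMod 2)).card * 2 ^ d ≤ S.card * 2 ^ n := by
  set σ : (ZMod d → ZMod 2) → (ZMod n → ZMod 2) := fun b => polyAct n (vecPoly b) (Pi.single 0 1)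
    with hσ
  have hfσ : ∀ b, fold hd (σ b) = b := by
    intro b
    rw [hσ, fold_polyAct, fold_single, polyAct_vecPoly_single]
  have hcard : ∀ e : ℕ, [NeZero e] → 2 ^ e = (Finset.univ : Finset (ZMod e → ZMod 2)).card := by
    intro e _
    rw [Finset.card_univ, Fintype.card_fun, ZMod.card, ZMod.card]
  rw [hcard d, hcard n, ← Finset.card_product, ← Finset.card_product]
  refine Finset.card_le_card_of_injOn (fun y => (fold hd y.1, y.1 + σ y.2)) ?_ ?_
  · rintro ⟨a, b⟩ h
    simpa using h
  · rintro ⟨a, b⟩ _ ⟨a', b'⟩ _ h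
    obtain ⟨h1, h2⟩ := Prod.mk.inj h
    have h3 := congrArg (fold hd) h2
    rw [map_add, map_add, hfσ, hfσ] at h3
    simp only at h1
    rw [h1] at h3
    have hb := add_left_cancel h3
    simp only at hb
    subst hb
    simpa using h2

theorem badMultiplier_subset {q k w : ℕ} [NeZero (q ^ (k + 1))] [NeZero (q ^ k)] (hq : 0 < q) :
    badMultiplier (q ^ (k + 1)) w ⊆
      ({a | fold (pow_dvd_pow q k.le_succ) a ∈ badMultiplier (q ^ k) (w / q)} : Finset _) ∪
        badPrimitive q k w := by
  classical
  intro a ha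
  obtain ⟨u, hu, hwt⟩ := (Finset.mem_filter.1 ha).2
  rw [Finset.mem_union]
  by_cases htop : polyAct (q ^ (k + 1)) (X ^ q ^ k - 1) u = 0
  · refine Or.inl ?_
    obtain ⟨u', hu'⟩ := exists_eq_comp_castHom_of_periodic (pow_dvd_pow q k.le_succ)
      (polyAct_X_pow_sub_one_eq_zero_iff.1 htop)
    have hpb : u = pullback (pow_dvd_pow q k.le_succ) u' := funext hu'
    rw [hpb, cyclicMul_pullback, hammingNorm_pullback _ (pow_succ' q k),
      hammingNorm_pullback _ (pow_succ' q k), ← mul_add] at hwt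
    simp only [badMultiplier, Finset.mem_filter, Finset.mem_univ, true_and]
    refine ⟨u', ?_, ?_⟩
    · rintro rfl
      exact hu (by rw [hpb, map_zero])
    · rw [Nat.le_div_iff_mul_le hq, mul_comm]
      exact hwt
  · exact Or.inr (by simpa [badPrimitive] using ⟨u, htop, hwt⟩)

/-- The proportion of bad multipliers of length `q ^ (k + 1)`, in terms of that of length
`q ^ k`. -/
theorem card_badMultiplier_div_le {q k w : ℕ} [NeZero (q ^ (k + 1))] [NeZero (q ^ k)]
    (hq : q.Prime) (hq' : 6048 ≤ q)
    (hirr : ∀ i, i ≠ 0 → Irreducible (cyclotomic (q ^ i) (ZMod 2))) (hw : w < q ^ (k + 1)) :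
    ((badMultiplier (q ^ (k + 1)) w).card : ℝ) / 2 ^ q ^ (k + 1) ≤
      ((badMultiplier (q ^ k) (w / q)).card : ℝ) / 2 ^ q ^ k +
        (5 * (weightBall (ZMod (q ^ (k + 1)) ⊕ ZMod (q ^ (k + 1))) w).card +
          k * 2 ^ q ^ k * (lowWeight (q ^ (k + 1))).card) / (q ^ (k + 1) * 2 ^ q ^ (k + 1)) := by
  classical
  have h1 := (Finset.card_le_card (badMultiplier_subset (q := q) (k := k) (w := w) hq.pos)).trans
    (Finset.card_union_le _ _)
  have h2 := card_preimage_fold_mul_le (pow_dvd_pow q k.le_succ) (badMultiplier (q ^ k) (w / q))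
  have h3 := mul_card_badPrimitive_le hq hq' hirr hw
  set P := ({a | fold (pow_dvd_pow q k.le_succ) a ∈ badMultiplier (q ^ k) (w / q)} :
    Finset (ZMod (q ^ (k + 1)) → ZMod 2)).card with hP
  have h1' : ((badMultiplier (q ^ (k + 1)) w).card : ℝ) ≤ P + (badPrimitive q k w).card := by
    exact_mod_cast h1
  have h2' : (P : ℝ) * 2 ^ q ^ k ≤ (badMultiplier (q ^ k) (w / q)).card * 2 ^ q ^ (k + 1) := by
    exact_mod_cast h2
  have hq0 : (0 : ℝ) < q := by exact_mod_cast hq.pos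
  calc ((badMultiplier (q ^ (k + 1)) w).card : ℝ) / 2 ^ q ^ (k + 1)
      ≤ (P + (badPrimitive q k w).card) / 2 ^ q ^ (k + 1) := by gcongr
    _ = P / 2 ^ q ^ (k + 1) + (badPrimitive q k w).card / 2 ^ q ^ (k + 1) := add_div _ _ _
    _ ≤ _ := by
      refine add_le_add ?_ ?_
      · rw [div_le_div_iff₀ (by positivity) (by positivity)]
        exact h2'
      · rw [div_le_div_iff₀ (by positivity) (by positivity)]
        calc ((badPrimitive q k w).card : ℝ) * (q ^ (k + 1) * 2 ^ q ^ (k + 1))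
            = (q ^ (k + 1) * (badPrimitive q k w).card) * 2 ^ q ^ (k + 1) := by ring
          _ ≤ _ := by gcongr

/-- Concatenating q short words of weight at most w/q gives a long word of weight at most w. -/
theorem card_weightBall_pow_le {ι κ : Type*} [Fintype ι] [DecidableEq ι] [Fintype κ]
    [DecidableEq κ] {q : ℕ} (hq : 0 < q) (e : κ ≃ Fin q × ι) (w : ℕ) :
    (weightBall ι (w / q)).card ^ q ≤ (weightBall κ w).card := by
  have h1 : (weightBall ι (w / q)).card ^ q =
      (Fintype.piFinset fun _ : Fin q => weightBall ι (w / q)).card := by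
    rw [Fintype.card_piFinset, Finset.prod_const, Finset.card_univ, Fintype.card_fin]
  rw [h1]
  refine Finset.card_le_card_of_injOn (fun y i => y (e i).1 (e i).2) ?_ ?_
  · intro y hy
    rw [Finset.mem_coe, Fintype.mem_piFinset] at hy
    refine mem_weightBall.2 ⟨fun h0 => ?_, ?_⟩
    · refine (mem_weightBall.1 (hy ⟨0, hq⟩)).1 (funext fun c => ?_)
      simpa using congrFun h0 (e.symm (⟨0, hq⟩, c))
    · have h2 : hammingNorm (fun i => y (e i).1 (e i).2) = ∑ b, hammingNorm (y b) := by
        have := hammingNorm_comp_equiv e (fun p => y p.1 p.2)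
        rw [show (fun i => y (e i).1 (e i).2) = (fun p : Fin q × ι => y p.1 p.2) ∘ e from rfl, this]
        simp only [hammingNorm, Finset.card_filter]
        rw [Fintype.sum_prod_type]
      beta_reduce
      rw [h2]
      calc ∑ b, hammingNorm (y b) ≤ ∑ _b : Fin q, w / q :=
            Finset.sum_le_sum fun b _ => (mem_weightBall.1 (hy b)).2
        _ = q * (w / q) := by simp
        _ ≤ w := Nat.mul_div_le w q
  · intro y _ y' _ h
    funext b c
    simpa using congrFun h (e.symm (b, c))

/-- Take q-th roots, with q ≤ 2^q and q^k = (√q^k)^2 ≤ (√q^k)^q. The gain of √q^k over q^k makes the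
contributions of the lower levels summable. -/
theorem card_weightBall_level_le {q k w : ℕ} [NeZero (q ^ (k + 1))] [NeZero (q ^ k)]
    (hq : 2 ≤ q)
    (h : ((weightBall (ZMod (q ^ (k + 1)) ⊕ ZMod (q ^ (k + 1))) w).card : ℝ) ≤
      q ^ (k + 1) * 2 ^ q ^ (k + 1)) :
    ((weightBall (ZMod (q ^ k) ⊕ ZMod (q ^ k)) (w / q)).card : ℝ) ≤
      2 * √q ^ k * 2 ^ q ^ k := by
  have e : (ZMod (q ^ (k + 1)) ⊕ ZMod (q ^ (k + 1))) ≃ Fin q × (ZMod (q ^ k) ⊕ ZMod (q ^ k)) :=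
    Fintype.equivOfCardEq (by
      rw [Fintype.card_prod, Fintype.card_sum, Fintype.card_sum, ZMod.card, ZMod.card,
        Fintype.card_fin]
      ring)
  have hpow := card_weightBall_pow_le (by omega) e w
  have hpow' : ((weightBall (ZMod (q ^ k) ⊕ ZMod (q ^ k)) (w / q)).card : ℝ) ^ q ≤
      (weightBall (ZMod (q ^ (k + 1)) ⊕ ZMod (q ^ (k + 1))) w).card := by exact_mod_cast hpow
  refine le_of_pow_le_pow_left₀ (n := q) (by omega) (by positivity) ((hpow'.trans h).trans ?_)
  have hq1 : (q : ℝ) ≤ 2 ^ q := by exact_mod_cast (Nat.lt_two_pow_self (n := q)).le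
  have hs1 : (1 : ℝ) ≤ √q ^ k := one_le_pow₀ (Real.one_le_sqrt.2 (by exact_mod_cast (by omega)))
  have hs2 : (q : ℝ) ^ k ≤ (√q ^ k) ^ q := by
    calc (q : ℝ) ^ k = (√q ^ k) ^ 2 := by
          rw [← pow_mul, mul_comm, pow_mul, Real.sq_sqrt (Nat.cast_nonneg q)]
      _ ≤ _ := pow_le_pow_right₀ hs1 hq
  calc (q : ℝ) ^ (k + 1) * 2 ^ q ^ (k + 1) = q * q ^ k * 2 ^ q ^ (k + 1) := by ring
    _ ≤ 2 ^ q * (√q ^ k) ^ q * 2 ^ q ^ (k + 1) := by gcongr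
    _ = _ := by rw [mul_pow, mul_pow, ← pow_mul 2 (q ^ k) q, pow_succ q k]

theorem lowWeight_term_le {q k : ℕ} [NeZero (q ^ (k + 1))] (hq : 6048 ≤ q) :
    (k * 2 ^ q ^ k * (lowWeight (q ^ (k + 1))).card : ℝ) / (q ^ (k + 1) * 2 ^ q ^ (k + 1)) ≤
      (1 / 4) ^ (k + 2) := by
  set L : ℝ := ((lowWeight (q ^ (k + 1))).card : ℝ) with hL
  have hL0 : 0 ≤ L := Nat.cast_nonneg _
  have hk : k + 1 ≤ q ^ k := Nat.succ_le_of_lt (Nat.lt_pow_self (by omega))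
  have hn : 6048 * q ^ k ≤ q ^ (k + 1) := by rw [pow_succ']; exact Nat.mul_le_mul_right _ hq
  have hLpow : L ^ 8 ≤ 2 ^ (6 * q ^ (k + 1)) := by
    rw [pow_mul]
    exact (card_lowWeight_pow_le _).trans (by norm_num)
  have key : (4 : ℝ) ^ (k + 2) * (2 ^ q ^ k * L) ≤ 2 ^ q ^ (k + 1) := by
    refine le_of_pow_le_pow_left₀ (n := 8) (by norm_num) (by positivity) ?_
    have e4 : (4 : ℝ) ^ (k + 2) = 2 ^ (2 * (k + 2)) := by rw [pow_mul]; norm_num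
    calc ((4 : ℝ) ^ (k + 2) * (2 ^ q ^ k * L)) ^ 8
        = 2 ^ (2 * (k + 2) * 8 + q ^ k * 8) * L ^ 8 := by
          rw [mul_pow, mul_pow, e4, ← pow_mul, ← pow_mul, pow_add]; ring
      _ ≤ 2 ^ (2 * (k + 2) * 8 + q ^ k * 8) * 2 ^ (6 * q ^ (k + 1)) := by gcongr
      _ = 2 ^ (2 * (k + 2) * 8 + q ^ k * 8 + 6 * q ^ (k + 1)) := by rw [← pow_add]
      _ ≤ 2 ^ (q ^ (k + 1) * 8) := pow_le_pow_right₀ (by norm_num) (by omega)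
      _ = _ := by rw [pow_mul]
  have hkn : (k : ℝ) ≤ q ^ (k + 1) := by
    have : k ≤ q ^ (k + 1) := by omega
    exact_mod_cast this
  have hq0 : (0 : ℝ) < q := by exact_mod_cast (by omega : 0 < q)
  rw [div_le_iff₀ (by positivity)]
  have e1 : (1 / 4 : ℝ) ^ (k + 2) * 4 ^ (k + 2) = 1 := by rw [← mul_pow]; norm_num
  calc (k : ℝ) * 2 ^ q ^ k * L = k * ((1 / 4) ^ (k + 2) * (4 ^ (k + 2) * (2 ^ q ^ k * L))) := by
        rw [← mul_assoc ((1 / 4 : ℝ) ^ (k + 2)), e1]; ring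
    _ ≤ q ^ (k + 1) * ((1 / 4) ^ (k + 2) * 2 ^ q ^ (k + 1)) := by gcongr
    _ = _ := by ring

theorem card_badMultiplier_pow_le {q : ℕ} [NeZero q] (hq : q.Prime) (hq' : 6048 ≤ q)
    (hirr : ∀ i, i ≠ 0 → Irreducible (cyclotomic (q ^ i) (ZMod 2))) (k w : ℕ) (hw : w < q ^ k)
    (hB : ((weightBall (ZMod (q ^ k) ⊕ ZMod (q ^ k)) w).card : ℝ) ≤ 2 * √q ^ k * 2 ^ q ^ k) :
    -- The bound is the partial sum of 4^{-i} for 1 ≤ i ≤ k; at each level the main term takes 3/4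
    -- of its summand and the low weights 1/4.
    ((badMultiplier (q ^ k) w).card : ℝ) / 2 ^ q ^ k ≤ (1 - (1 / 4) ^ k) / 3 := by
  induction k generalizing w with
  | zero =>
    have h : (badMultiplier (q ^ 0) w).card = 0 := by
      rw [Finset.card_eq_zero, Finset.eq_empty_iff_forall_notMem]
      intro a ha
      obtain ⟨u, hu, hwt⟩ := (Finset.mem_filter.1 ha).2
      have := hammingNorm_pos_iff.2 hu
      rw [pow_zero] at hw
      omega
    rw [h]
    simp
  | succ k ih =>
    -- 77^2 = 5929 ≤ 6048, and 77 · 3/16 exceeds the 10 required below.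
    have hs : (77 : ℝ) ≤ √q := by
      rw [Real.le_sqrt' (by norm_num)]
      exact le_trans (by norm_num) (Nat.cast_le (α := ℝ).2 hq')
    have hss : √(q : ℝ) ^ (k + 1) * √q ^ (k + 1) = q ^ (k + 1) := by
      rw [← mul_pow, Real.mul_self_sqrt (Nat.cast_nonneg q)]
    have hs2 : (2 : ℝ) ≤ √q ^ (k + 1) :=
      le_trans (by linarith) (le_self_pow₀ (by linarith) k.succ_ne_zero)
    have hprev := ih (w / q)
      ((Nat.div_lt_iff_lt_mul hq.pos).2 (by rwa [← pow_succ]))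
      (card_weightBall_level_le hq.two_le (hB.trans (by
        rw [← hss]
        gcongr)))
    have hlow := lowWeight_term_le (k := k) hq'
    have hrec := card_badMultiplier_div_le hq hq' hirr hw
    rw [add_div] at hrec
    have hpos : 0 < √(q : ℝ) ^ (k + 1) := by linarith
    have hmain : 5 * ((weightBall (ZMod (q ^ (k + 1)) ⊕ ZMod (q ^ (k + 1))) w).card : ℝ) /
        (q ^ (k + 1) * 2 ^ q ^ (k + 1)) ≤ 3 / 4 * (1 / 4) ^ (k + 1) := by
      have hs3 : (77 : ℝ) * 4 ^ k ≤ √q ^ (k + 1) := by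
        rw [pow_succ']
        gcongr
        linarith
      have e1 : (1 / 4 : ℝ) ^ k * 4 ^ k = 1 := by rw [← mul_pow]; norm_num
      have h10 : 10 ≤ 3 / 4 * (1 / 4) ^ (k + 1) * √(q : ℝ) ^ (k + 1) := by
        calc (10 : ℝ) ≤ 3 / 4 * (1 / 4) * 77 * ((1 / 4) ^ k * 4 ^ k) := by rw [e1]; norm_num
          _ = 3 / 4 * (1 / 4) ^ (k + 1) * (77 * 4 ^ k) := by ring
          _ ≤ _ := by gcongr
      rw [div_le_iff₀ (by rw [← hss]; positivity), ← hss]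
      calc 5 * ((weightBall (ZMod (q ^ (k + 1)) ⊕ ZMod (q ^ (k + 1))) w).card : ℝ)
          ≤ 5 * (2 * √q ^ (k + 1) * 2 ^ q ^ (k + 1)) := by gcongr
        _ = 10 * (√q ^ (k + 1) * 2 ^ q ^ (k + 1)) := by ring
        _ ≤ 3 / 4 * (1 / 4) ^ (k + 1) * √q ^ (k + 1) * (√q ^ (k + 1) * 2 ^ q ^ (k + 1)) := by
            gcongr
        _ = _ := by ring
    have e1 : (1 / 4 : ℝ) ^ (k + 1) = (1 / 4) ^ k * (1 / 4) := pow_succ _ _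
    have e2 : (1 / 4 : ℝ) ^ (k + 2) = (1 / 4) ^ k * (1 / 4) * (1 / 4) := by ring
    linarith

/-! ### From a good multiplier to the code. -/

/-- The double circulant code of a multiplier. -/
noncomputable def circulantMap {n N : ℕ} [NeZero n] (e : Fin N ≃ ZMod n ⊕ ZMod n)
    (a : ZMod n → ZMod 2) : (ZMod n → ZMod 2) →ₗ[ZMod 2] (Fin N → ZMod 2) where
  toFun u := Sum.elim u (cyclicMul a u) ∘ e
  map_add' u v := by
    ext i
    rcases h : e i with g | g <;> simp [h]
  map_smul' r u := by
    ext i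
    rcases h : e i with g | g <;> simp [h]

theorem circulantMap_injective {n N : ℕ} [NeZero n] (e : Fin N ≃ ZMod n ⊕ ZMod n)
    (a : ZMod n → ZMod 2) : Function.Injective (circulantMap e a) := by
  intro u v h
  ext g
  have := congrFun h (e.symm (Sum.inl g))
  simpa [circulantMap] using this

theorem hammingNorm_circulantMap {n N : ℕ} [NeZero n] (e : Fin N ≃ ZMod n ⊕ ZMod n)
    (a u : ZMod n → ZMod 2) :
    hammingNorm (circulantMap e a u) = hammingNorm u + hammingNorm (cyclicMul a u) := by
  rw [← hammingNorm_sumElim]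
  exact hammingNorm_comp_equiv e _

theorem exists_code_of_notMem_badMultiplier {n w : ℕ} [NeZero n] (e : Fin (2 * n) ≃ ZMod n ⊕ ZMod n)
    {a : ZMod n → ZMod 2} (ha : a ∉ badMultiplier n w) :
    ∃ d, w < d ∧ IsBinaryLinearCode (2 * n) n d (LinearMap.range (circulantMap e a)) := by
  classical
  set S := {d : ℕ | ∃ x ∈ LinearMap.range (circulantMap e a), x ≠ 0 ∧ hammingNorm x = d} with hS
  have hne : S.Nonempty := by
    refine ⟨_, circulantMap e a (Pi.single 0 1), LinearMap.mem_range_self _ _, ?_, rfl⟩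
    rw [Ne, map_eq_zero_iff _ (circulantMap_injective e a)]
    intro h
    simpa using congrFun h 0
  refine ⟨sInf S, ?_, ?_, Nat.sInf_mem hne, fun x hx => Nat.sInf_le hx⟩
  · obtain ⟨x, ⟨u, rfl⟩, hx0, hx⟩ := Nat.sInf_mem hne
    rw [← hx, hammingNorm_circulantMap]
    by_contra hcon
    refine ha (Finset.mem_filter.2 ⟨Finset.mem_univ _, u, ?_, by omega⟩)
    rintro rfl
    exact hx0 (map_zero _)
  · rw [LinearMap.finrank_range_of_inj (circulantMap_injective e a),
      Module.finrank_fintype_fun_eq_card, ZMod.card]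

theorem sq_le_three_mul_two_pow (n : ℕ) : n ^ 2 ≤ 3 * 2 ^ n := by
  have h1 := Nat.choose_le_two_pow n 2
  have h2 := Nat.lt_two_pow_self (n := n)
  have h3 : n ^ 2 = n.choose 2 * 2 + n := by
    rw [Nat.choose_two_right, Nat.div_mul_cancel (Nat.even_mul_pred_self n).two_dvd]
    cases n with
    | zero => rfl
    | succ n => rw [Nat.add_sub_cancel]; ring
  omega

/-- The middle layer alone has at least 4^n / (2n) vectors. Hence the threshold radius is at most n,
and the radius just below it satisfies the w < n required by the counting lemmas. -/
theorem le_card_weightBall_self {n : ℕ} [NeZero n] :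
    (1 / 100 : ℝ) * n * 2 ^ n ≤ (weightBall (ZMod n ⊕ ZMod n) n).card := by
  have hn : 0 < n := Nat.pos_of_ne_zero (NeZero.ne n)
  have h1 : n.centralBinom ≤ (weightBall (ZMod n ⊕ ZMod n) n).card := by
    have : n.centralBinom =
        ({x : ZMod n ⊕ ZMod n → ZMod 2 | hammingNorm x = n} : Finset _).card := by
      rw [card_hammingNorm_eq, Fintype.card_sum, ZMod.card, ← two_mul, Nat.centralBinom]
    rw [this]
    refine Finset.card_le_card fun x hx => ?_
    have hx' : hammingNorm x = n := (Finset.mem_filter.1 hx).2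
    refine mem_weightBall.2 ⟨?_, hx'.le⟩
    rintro rfl
    rw [hammingNorm_zero] at hx'
    omega
  have h2 : (4 : ℝ) ^ n ≤ 2 * n * (weightBall (ZMod n ⊕ ZMod n) n).card := by
    have := (Nat.four_pow_le_two_mul_self_mul_centralBinom n hn).trans
      (Nat.mul_le_mul_left (2 * n) h1)
    exact_mod_cast this
  have h3 : (n : ℝ) ^ 2 ≤ 3 * 2 ^ n := by exact_mod_cast sq_le_three_mul_two_pow n
  have e : (4 : ℝ) ^ n = 2 ^ n * 2 ^ n := by rw [← mul_pow]; norm_num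
  have hn' : (0 : ℝ) < 2 * n := by positivity
  refine le_of_mul_le_mul_left (le_trans ?_ h2) hn'
  rw [e]
  calc 2 * (n : ℝ) * (1 / 100 * n * 2 ^ n) = n ^ 2 * (1 / 50 * 2 ^ n) := by ring
    _ ≤ 3 * 2 ^ n * (1 / 50 * 2 ^ n) := by gcongr
    _ ≤ _ := by nlinarith [show (0 : ℝ) < 2 ^ n * 2 ^ n by positivity]

theorem exists_code_of_prime_pow {q : ℕ} (hq : q.Prime) (hq' : 6048 ≤ q)
    (hirr : ∀ i, i ≠ 0 → Irreducible (cyclotomic (q ^ i) (ZMod 2))) (k : ℕ) :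
    ∃ (d : ℕ) (C : Submodule (ZMod 2) (Fin (2 * q ^ (k + 1)) → ZMod 2)),
      IsBinaryLinearCode (2 * q ^ (k + 1)) (q ^ (k + 1)) d C ∧
        (1 / 100 : ℝ) * (q ^ (k + 1) : ℕ) * 2 ^ q ^ (k + 1) ≤
          (puncturedBall (2 * q ^ (k + 1)) d).card := by
  classical
  have : NeZero q := ⟨hq.ne_zero⟩
  have hq0 : (0 : ℝ) < q := by exact_mod_cast hq.pos
  have hex : ∃ w, (1 / 100 : ℝ) * (q ^ (k + 1) : ℕ) * 2 ^ q ^ (k + 1) ≤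
      (weightBall (ZMod (q ^ (k + 1)) ⊕ ZMod (q ^ (k + 1))) w).card :=
    ⟨_, le_card_weightBall_self⟩
  -- The radius w is the last one whose ball is below the threshold; a code of distance d > w then
  -- has a ball above it.
  obtain ⟨w, hw⟩ : ∃ w, Nat.find hex = w + 1 := by
    refine Nat.exists_eq_succ_of_ne_zero fun h0 => ?_
    have h1 := Nat.find_spec hex
    rw [h0] at h1
    have h2 : weightBall (ZMod (q ^ (k + 1)) ⊕ ZMod (q ^ (k + 1))) 0 = ∅ := by
      rw [Finset.eq_empty_iff_forall_notMem]
      intro x hx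
      obtain ⟨hx0, hx1⟩ := mem_weightBall.1 hx
      have := hammingNorm_pos_iff.2 hx0
      omega
    rw [h2, Finset.card_empty, Nat.cast_zero] at h1
    have h3 : (0 : ℝ) < 1 / 100 * (q ^ (k + 1) : ℕ) * 2 ^ q ^ (k + 1) := by
      push_cast
      positivity
    exact absurd h1 (not_le.2 h3)
  have hlt := Nat.find_min hex (m := w) (by omega)
  have hspec := Nat.find_spec hex
  have hwn : w < q ^ (k + 1) := by
    have := Nat.find_min' hex (le_card_weightBall_self (n := q ^ (k + 1)))
    omega
  rw [hw] at hspec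
  rw [not_le] at hlt
  have hlt' : ((weightBall (ZMod (q ^ (k + 1)) ⊕ ZMod (q ^ (k + 1))) w).card : ℝ) ≤
      1 / 100 * (q ^ (k + 1) * 2 ^ q ^ (k + 1)) := by
    push_cast at hlt
    linarith
  have hpos : (0 : ℝ) < q ^ (k + 1) * 2 ^ q ^ (k + 1) := by positivity
  have hprev := card_badMultiplier_pow_le hq hq' hirr k (w / q)
    ((Nat.div_lt_iff_lt_mul hq.pos).2 (by rwa [← pow_succ]))
    (card_weightBall_level_le hq.two_le (by linarith))
  have hlow := lowWeight_term_le (k := k) hq'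
  have hrec := card_badMultiplier_div_le hq hq' hirr hwn
  rw [add_div] at hrec
  have hmain : 5 * ((weightBall (ZMod (q ^ (k + 1)) ⊕ ZMod (q ^ (k + 1))) w).card : ℝ) /
      (q ^ (k + 1) * 2 ^ q ^ (k + 1)) ≤ 1 / 20 := by
    rw [div_le_iff₀ hpos]
    linarith
  have hlow' : (1 / 4 : ℝ) ^ (k + 2) ≤ 1 / 16 := by
    calc (1 / 4 : ℝ) ^ (k + 2) ≤ (1 / 4) ^ 2 :=
          pow_le_pow_of_le_one (by norm_num) (by norm_num) (by omega)
      _ = 1 / 16 := by norm_num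
  have hgeom : (0 : ℝ) ≤ (1 / 4) ^ k := by positivity
  -- The three proportions are at most 1/3 (periodic words), 1/20 = 5/100 (main term) and 1/16 (low
  -- weights).
  have hbad : ((badMultiplier (q ^ (k + 1)) w).card : ℝ) / 2 ^ q ^ (k + 1) < 1 := by linarith
  rw [div_lt_one (by positivity)] at hbad
  obtain ⟨a, ha⟩ : ∃ a, a ∉ badMultiplier (q ^ (k + 1)) w := by
    by_contra! hall
    rw [Finset.eq_univ_iff_forall.2 hall, Finset.card_univ, Fintype.card_fun, ZMod.card,
      ZMod.card] at hbad
    norm_num at hbad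
  have e : Fin (2 * q ^ (k + 1)) ≃ ZMod (q ^ (k + 1)) ⊕ ZMod (q ^ (k + 1)) :=
    Fintype.equivOfCardEq (by rw [Fintype.card_fin, Fintype.card_sum, ZMod.card, two_mul])
  obtain ⟨d, hwd, hcode⟩ := exists_code_of_notMem_badMultiplier e ha
  refine ⟨d, _, hcode, hspec.trans ?_⟩
  have hball : (puncturedBall (2 * q ^ (k + 1)) d).card =
      (weightBall (ZMod (q ^ (k + 1)) ⊕ ZMod (q ^ (k + 1))) d).card := card_weightBall_congr e d
  rw [hball]
  refine Nat.cast_le.2 (Finset.card_le_card fun x hx => ?_)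
  obtain ⟨hx0, hx1⟩ := mem_weightBall.1 hx
  exact mem_weightBall.2 ⟨hx0, by omega⟩

theorem theorem2 :
    ∃ b : ℝ, 0 < b ∧
      {n : ℕ | ∃ (d : ℕ) (C : Submodule (ZMod 2) (Fin (2 * n) → ZMod 2)),
        IsBinaryLinearCode (2 * n) n d C ∧
          b * n * 2 ^ n ≤ ((puncturedBall (2 * n) d).card : ℝ)}.Infinite := by
  refine ⟨1 / 100, by norm_num, Set.infinite_of_injective_forall_mem
    (f := fun k : ℕ => 6659 ^ (k + 1)) ?_ fun k => ?_⟩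
  · intro k k' h
    exact Nat.succ_injective (Nat.pow_right_injective (by norm_num) h)
  · exact exists_code_of_prime_pow prime_6659 (by norm_num)
      (fun i hi => irreducible_cyclotomic_6659_pow hi) k
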